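/- Let $n\ge 1$, let $S_n$ be the symmetric group on $[n]=\{1,\dots,n\}$, and let $\ell$ be its Coxeter length with respect to the adjacent transpositions $s_i=(i,i+1)$, $1\le i\le n-1$. Write $w\to w'$ if there is a finite (possibly empty) sequence of steps from $w$ to $w'$, each of the form $u\mapsto s_ius_i$ with $\ell(s_ius_i)\le\ell(u)$, and write $w\approx w'$ if $w\to w'$ and $w'\to w$. For a composition $\alpha=(\alpha_1,\dots,\alpha_l)$ of $n$, the element in stair form $\sigma_\alpha\in S_n$ is obtained by cutting the list $(x_1,\dots,x_n)=(1,n,2,n-1,\dots)$ (that is, $x_{2i-1}=i$ and $x_{2i}=n-i+1$) into consecutive blocks of sizes $\alpha_1,\dots,\alpha_l$ and reading each block as a cycle. Let $\Sigma_\alpha$ be the $\approx$-equivalence class of $\sigma_\alpha$. The standardization of a cycle $(c_1,\dots,c_r)$ is the $r$-cycle in $S_r$ obtained by replacing each entry by its rank among $c_1,\dots,c_r$. An $r$-cycle $\tau\in S_r$ is oscillating if $\tau([m])=\{r-m+1,\dots,r\}$ for some positive integer $m\in\{\frac{r-1}2,\frac r2,\frac{r+1}2\}$. It has connected intervals if for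 every integer $j$ with $1\le j\le \frac r2$ the set $M=\{j,\dots,r-j+1\}$ equals $\{x,\tau(x),\dots,\tau^{|M|-1}(x)\}$ for some $x\in M$. A permutation is oscillating (has connected intervals) if the standardization of each of its cycles, trivial ones included, is oscillating (has connected intervals). Let $1\le k\le n$ and let $\alpha=(k,1^{n-k})$ be a hook. A permutation $\sigma\in S_n$ of cycle type $\alpha$ satisfies the hook properties if (1) $\sigma$ is oscillating, (2) $\sigma$ has connected intervals, and (3) if $k>1$, then $i$ and $n-i+1$ appear in the cycle of length $k$ of $\sigma$ for all $1\le i\le\lfloor k/2\rfloor$. For $n_1+n_2=n$, $\sigma_1\in S_{n_1}$ and $\sigma_2\in S_{n_2}$, the inductive product $\sigma_1\star\sigma_2\in S_n$ is the permutation whose cycles are those of $\sigma_1$ with $n_2$ added to each entry greater than $\lceil n_1/2\rceil$, together with those of $\sigma_2$ with $\lceil n_1/2\rceil$ added to each entry. **Theorem.** Let $\alpha=(k,1^{n-k})$ with $1\le k\le n$ be a hook. (a) For every $\sigma\in S_n$ of cycle type $\alpha$ (with $k$ odd or even), $\sigma\in\Sigma_\alpha$ if and only if $\sigma$ satisfies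 the hook properties. (b) If $k$ is even, then $\sigma\mapsto\sigma\star\mathrm{id}$, where $\mathrm{id}\in S_{n-k}$, is a bijection from $\Sigma_{(k)}$ onto $\Sigma_\alpha$. -/

import Mathlib

/-! The set `[n] = {1, …, n}` is modelled by `Fin n`: the number `i ∈ [n]` is the element of
`Fin n` with value `i - 1`. The symmetric group on `[n]` is `Equiv.Perm (Fin n)`. -/

namespace SymMax

open Equiv

/-- The discrete interval `[a, b] ∩ [n]`; the element `i : Fin n` stands for the number `i + 1`. -/
def interval (n a b : ℕ) : Set (Fin n) := {i | a ≤ (i : ℕ) + 1 ∧ (i : ℕ) + 1 ≤ b}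

/-! ### Length, the relation `≈` and its classes -/

/-- The Coxeter generators of the symmetric group: the adjacent transpositions `(i, i + 1)`. -/
def adjTranspositions (n : ℕ) : Set (Perm (Fin n)) :=
  {s | ∃ i j : Fin n, (j : ℕ) = (i : ℕ) + 1 ∧ s = swap i j}

/-- The Coxeter length: the minimal length of a word in the adjacent transpositions. -/
noncomputable def length {n : ℕ} (w : Perm (Fin n)) : ℕ :=
  sInf {r | ∃ l : List (Perm (Fin n)),
    (∀ s ∈ l, s ∈ adjTranspositions n) ∧ l.prod = w ∧ l.length = r}

/-- One step `w → w'`: `w' = s w s` for an adjacent transposition `s`, and `ℓ(w') ≤ ℓ(w)`. -/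
def Step {n : ℕ} (w w' : Perm (Fin n)) : Prop :=
  ∃ s ∈ adjTranspositions n, w' = s * w * s ∧ length w' ≤ length w

/-- The relation `w → w'`: there is a finite (possibly empty) sequence of steps. -/
def Arrow {n : ℕ} (w w' : Perm (Fin n)) : Prop := Relation.ReflTransGen Step w w'

/-- The relation `w ≈ w'`. -/
def Approx {n : ℕ} (w w' : Perm (Fin n)) : Prop := Arrow w w' ∧ Arrow w' w

/-! ### Elements in stair form and the classes `Σ_α` -/

/-- The entry with (zero-based) index `p` of the list `1, n, 2, n - 1, …` of the elements of `[n]`;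
that is `x_{2i-1} = i` and `x_{2i} = n - i + 1`. -/
def stairEntry {n : ℕ} (p : Fin n) : Fin n :=
  if _h : (p : ℕ) % 2 = 0 then ⟨(p : ℕ) / 2, by omega⟩ else ⟨n - ((p : ℕ) + 1) / 2, by omega⟩

/-- The element in stair form `σ_α`: the list `1, n, 2, n - 1, …` is cut into consecutive blocks of
sizes `α₁, α₂, …`, and each block is read as a cycle. -/
def stairElement {n : ℕ} (α : Composition n) : Perm (Fin n) :=
  (((List.ofFn (stairEntry (n := n))).splitWrtComposition α).map List.formPerm).prod

/-- The class `Σ_α`: the `≈`-equivalence class of the element in stair form `σ_α`. -/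
def SigmaClass {n : ℕ} (α : Composition n) : Set (Perm (Fin n)) :=
  {σ | Approx (stairElement α) σ}

/-- The hook `(k, 1^{n-k})`. -/
def hook (n k : ℕ) (hk : 1 ≤ k) (hkn : k ≤ n) : Composition n where
  blocks := k :: List.replicate (n - k) 1
  blocks_pos := by
    intro i hi
    rcases List.mem_cons.1 hi with rfl | hi
    · exact hk
    · rw [List.eq_of_mem_replicate hi]
      exact Nat.one_pos
  blocks_sum := by simp; omega

/-- `σ` is of type `α`: the sizes of all the cycles of `σ`, trivial ones included, are the parts
of `α`, up to order. -/
def IsOfType {n : ℕ} (σ : Perm (Fin n)) (α : Composition n) : Prop :=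
  σ.partition.parts = (α.blocks : Multiset ℕ)

/-! ### Cycle standardization, oscillation, connected intervals -/

/-- The set of the entries of the cycle of `σ` that contains `x`. -/
def orbit {n : ℕ} (σ : Perm (Fin n)) (x : Fin n) : Finset (Fin n) :=
  Finset.univ.filter fun y => σ.SameCycle x y

/-- The cycle standardization of the cycle of `σ` (trivial or not) that contains `x`: the entries
of the cycle are replaced by their ranks among these entries. -/
def cst {n : ℕ} (σ : Perm (Fin n)) (x : Fin n) : Perm (Fin (orbit σ x).card) :=
  ((orbit σ x).orderIsoOfFin rfl).toEquiv.symm.permCongr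
    (σ.subtypePerm (p := fun y => y ∈ orbit σ x) fun y => by simp [orbit])

/-- Oscillation for an `n`-cycle `σ` in the symmetric group on `[n]`: `σ([m]) = [n - m + 1, n]` for
a positive integer `m` among `(n-1)/2`, `n/2`, `(n+1)/2`. -/
def CycleOscillating {n : ℕ} (σ : Perm (Fin n)) : Prop :=
  ∃ m : ℕ, 0 < m ∧ (2 * m + 1 = n ∨ 2 * m = n ∨ 2 * m = n + 1) ∧
    σ '' interval n 1 m = interval n (n - m + 1) n

/-- `M` is connected in `σ`: `M = {x, σ(x), …, σ^{|M|-1}(x)}` for some `x ∈ M`. -/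
def IsConnectedIn {n : ℕ} (σ : Perm (Fin n)) (M : Set (Fin n)) : Prop :=
  ∃ x ∈ M, M = {y | ∃ j < M.ncard, y = (σ ^ j) x}

/-- Connected intervals for an `n`-cycle `σ` in the symmetric group on `[n]`. -/
def CycleConnectedIntervals {n : ℕ} (σ : Perm (Fin n)) : Prop :=
  ∀ k : ℕ, 1 ≤ k → 2 * k ≤ n → IsConnectedIn σ (interval n k (n - k + 1))

/-- A permutation is oscillating if the standardization of each of its cycles is. -/
def Oscillating {n : ℕ} (σ : Perm (Fin n)) : Prop := ∀ x, CycleOscillating (cst σ x)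

/-- A permutation has connected intervals if the standardization of each of its cycles has. -/
def ConnectedIntervals {n : ℕ} (σ : Perm (Fin n)) : Prop :=
  ∀ x, CycleConnectedIntervals (cst σ x)

/-- The hook properties of a permutation `σ` of type `(k, 1^{n-k})`. Here `k / 2` is the integer
part, which is `(k - 1) / 2` for odd `k`; the numbers `i` and `n - i + 1` are the elements `a` and
`b` of `Fin n` with values `i - 1` and `n - i`. -/
structure HookProperties {n : ℕ} (k : ℕ) (σ : Perm (Fin n)) : Prop where
  oscillating : Oscillating σ
  connectedIntervals : ConnectedIntervals σ
  mem_cycle : 1 < k → ∃ c ∈ σ.cycleFactorsFinset, c.support.card = k ∧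
    ∀ i : ℕ, 1 ≤ i → i ≤ k / 2 → ∀ a b : Fin n, (a : ℕ) + 1 = i → (b : ℕ) + 1 = n - i + 1 →
      a ∈ c.support ∧ b ∈ c.support

/-! ### The inductive product -/

/-- The map `φ₁ : [n₁] → [n]`, which adds `n₂` to each entry greater than `⌈n₁/2⌉`. -/
def embLeft {n n₁ n₂ : ℕ} (h : n₁ + n₂ = n) : Fin n₁ ↪ Fin n where
  toFun i := if (i : ℕ) + 1 ≤ (n₁ + 1) / 2 then ⟨i, by omega⟩ else ⟨(i : ℕ) + n₂, by omega⟩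
  inj' := by
    intro i j hij
    ext
    dsimp only at hij
    split_ifs at hij <;> simp only [Fin.mk.injEq] at hij <;> omega

/-- The map `φ₂ : [n₂] → [n]`, which adds `⌈n₁/2⌉` to each entry. -/
def embRight {n n₁ n₂ : ℕ} (h : n₁ + n₂ = n) : Fin n₂ ↪ Fin n where
  toFun i := ⟨(i : ℕ) + (n₁ + 1) / 2, by omega⟩
  inj' := by
    intro i j hij
    ext
    simp only [Fin.mk.injEq] at hij
    omega

/-- The inductive product `σ₁ ⋆ σ₂`: its cycles are those of `σ₁` and of `σ₂` with the entries
altered by `φ₁` and by `φ₂`, respectively. -/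
def inductiveProduct {n n₁ n₂ : ℕ} (h : n₁ + n₂ = n) (σ₁ : Perm (Fin n₁)) (σ₂ : Perm (Fin n₂)) :
    Perm (Fin n) :=
  σ₁.viaFintypeEmbedding (embLeft h) * σ₂.viaFintypeEmbedding (embRight h)

end SymMax

/-! Length is the number of inversions, and conjugation by an adjacent transposition changes it by
-2, 0 or 2. Along steps leading from `w` to `w'` and back it stays constant, so `≈` is generated by
`Exchange`, conjugation at a place where exactly one of `w`, `w⁻¹` ascends
(`approx_iff_reflTransGen`). This relation is symmetric, and a class is an orbit under exchanges.

The hook properties are recast as `HookCycle`, a list of conditions on single edges `x → σ x`. Let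
level `j` be the set of elements of depth at least `j`: each level is left by at most one edge,
hence entered by at most one. By `exit_lt_iff_entry_lt` these two edges point in the same direction,
up or down. This determines the cycle near an ascent `a, a + 1` of small elements (`ascent_lo`) so
precisely that conjugating there preserves `HookCycle`. Reflection and inversion give the remaining
cases (`HookCycle.exchange`), so the whole class of the stair element consists of hook cycles.

Conversely, once a moved middle element sits at position `p`, the stair element is the only hook
cycle of its support size that descends at all the relevant adjacent pairs. Any other one has an
ascent there, which is an exchange lowering `potential`, apart from one kind of exchange that
reverses the core of the cycle and is needed at most once (`reflTransGen_of_progress`). So every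
hook cycle of the right support size reaches the stair element.

Finally, `OuterEmb.hookCycle_iff` transports `HookCycle` along increasing embeddings that reach all
outer elements. Applied to the enumeration of the long cycle it gives (a); applied to `embLeft` it
gives (b), because for even `k` the moved elements are exactly the outer ones. -/

namespace SymMax

open Equiv

/-! ### The Coxeter length is the number of inversions -/

section Inversions

variable {n : ℕ}

/-- The inversions of `w`: the pairs `i < j` with `w j < w i`. -/
def inversions (w : Perm (Fin n)) : Finset (Fin n × Fin n) :=
  Finset.univ.filter fun q => q.1 < q.2 ∧ w q.2 < w q.1

theorem mem_inversions {w : Perm (Fin n)} {x y : Fin n} :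
    (x, y) ∈ inversions w ↔ x < y ∧ w y < w x := by
  simp [inversions]

/-- Adjacent numbers compare alike with everything else, so only the pair itself can change its
order. -/
theorem swap_lt_swap {a b x y : Fin n} (hab : (b : ℕ) = a + 1) (hxy : x < y)
    (hne : ¬(x = a ∧ y = b)) : swap a b x < swap a b y := by
  simp only [swap_apply_def, Fin.ext_iff, Fin.lt_def] at *
  split_ifs <;> omega

theorem lt_of_swap_lt_swap {a b x y : Fin n} (hab : (b : ℕ) = a + 1)
    (hxy : swap a b x < swap a b y) (hne : ¬(x = b ∧ y = a)) : x < y := by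
  simp only [swap_apply_def, Fin.ext_iff, Fin.lt_def] at *
  split_ifs at hxy <;> omega

/-- The old inversions are carried along by the relabelling of positions, and the former ascent is
the one new inversion. -/
theorem inversions_mul_swap {a b : Fin n} (hab : (b : ℕ) = a + 1) {w : Perm (Fin n)}
    (h : w a < w b) :
    inversions (w * swap a b) =
      insert (a, b) ((inversions w).map ((swap a b).prodCongr (swap a b)).toEmbedding) := by
  have hlt : a < b := by rw [Fin.lt_def]; omega
  ext ⟨x, y⟩
  rw [Finset.mem_insert, Finset.mem_map_equiv, mem_inversions, prodCongr_symm, prodCongr_apply,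
    Prod.map_apply, mem_inversions, symm_swap, Perm.mul_apply, Perm.mul_apply, Prod.mk.injEq]
  constructor
  · rintro ⟨hxy, hw⟩
    by_cases hne : x = a ∧ y = b
    · exact Or.inl hne
    · exact Or.inr ⟨swap_lt_swap hab hxy hne, hw⟩
  · rintro (⟨rfl, rfl⟩ | ⟨hxy, hw⟩)
    · simpa using ⟨hlt, h⟩
    · refine ⟨lt_of_swap_lt_swap hab hxy ?_, hw⟩
      rintro ⟨rfl, rfl⟩
      simp only [swap_apply_left, swap_apply_right] at hw
      exact absurd hw (not_lt_of_gt h)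

theorem card_inversions_mul_swap {a b : Fin n} (hab : (b : ℕ) = a + 1) {w : Perm (Fin n)}
    (h : w a < w b) : (inversions (w * swap a b)).card = (inversions w).card + 1 := by
  rw [inversions_mul_swap hab h, Finset.card_insert_of_notMem, Finset.card_map]
  have hlt : a < b := by rw [Fin.lt_def]; omega
  rw [Finset.mem_map_equiv, prodCongr_symm, prodCongr_apply, Prod.map_apply, mem_inversions,
    symm_swap, swap_apply_left, swap_apply_right]
  exact fun hh => absurd hh.1 (not_lt_of_gt hlt)

theorem card_inversions_mul_swap_of_gt {a b : Fin n} (hab : (b : ℕ) = a + 1) {w : Perm (Fin n)}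
    (h : w b < w a) : (inversions (w * swap a b)).card + 1 = (inversions w).card := by
  have := card_inversions_mul_swap (w := w * swap a b) hab (by simpa using h)
  rw [mul_assoc, swap_mul_self, mul_one] at this
  exact this.symm

theorem card_inversions_inv (w : Perm (Fin n)) :
    (inversions w⁻¹).card = (inversions w).card := by
  refine Finset.card_bij (fun q _ => (w⁻¹ q.2, w⁻¹ q.1)) ?_ ?_ ?_
  · rintro ⟨x, y⟩ h
    rw [mem_inversions] at h
    simpa [mem_inversions] using h.symm
  · rintro ⟨x, y⟩ _ ⟨x', y'⟩ _ h
    simp only [Prod.mk.injEq, EmbeddingLike.apply_eq_iff_eq] at h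
    rw [h.1, h.2]
  · rintro ⟨x, y⟩ h
    rw [mem_inversions] at h
    exact ⟨(w y, w x), by simpa [mem_inversions] using h.symm, by simp⟩

theorem card_inversions_swap_mul {a b : Fin n} (hab : (b : ℕ) = a + 1) {w : Perm (Fin n)}
    (h : w⁻¹ a < w⁻¹ b) : (inversions (swap a b * w)).card = (inversions w).card + 1 := by
  have := card_inversions_mul_swap hab h
  rwa [card_inversions_inv, ← card_inversions_inv, mul_inv_rev, inv_inv, swap_inv] at this

theorem card_inversions_swap_mul_of_gt {a b : Fin n} (hab : (b : ℕ) = a + 1) {w : Perm (Fin n)}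
    (h : w⁻¹ b < w⁻¹ a) : (inversions (swap a b * w)).card + 1 = (inversions w).card := by
  have := card_inversions_mul_swap_of_gt hab h
  rwa [card_inversions_inv, ← card_inversions_inv, mul_inv_rev, inv_inv, swap_inv] at this

/-- A finite linear order has no order automorphism but the identity. -/
theorem eq_one_of_forall_lt {w : Perm (Fin n)}
    (h : ∀ a b : Fin n, (b : ℕ) = a + 1 → w a < w b) : w = 1 := by
  have hmono : StrictMono w := by
    cases n with
    | zero => exact fun a => a.elim0
    | succ m => exact Fin.strictMono_iff_lt_succ.2 fun i => h _ _ (by simp)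
  ext x
  have := congrArg (fun f : Fin n ≃o Fin n => f x)
    (Subsingleton.elim (StrictMono.orderIsoOfSurjective w hmono w.surjective) (OrderIso.refl _))
  simpa using congrArg Fin.val this

/-- Bubble sort: while some adjacent pair descends, a swap on the right removes one inversion. -/
theorem exists_word (w : Perm (Fin n)) :
    ∃ l : List (Perm (Fin n)), (∀ s ∈ l, s ∈ adjTranspositions n) ∧ l.prod = w ∧
      l.length = (inversions w).card := by
  induction hm : (inversions w).card generalizing w with
  | zero =>
    refine ⟨[], by simp, ?_, rfl⟩
    rw [List.prod_nil]
    refine (eq_one_of_forall_lt fun a b hab => ?_).symm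
    by_contra hlt
    have hlt' : a < b := by rw [Fin.lt_def]; omega
    have hmem : (a, b) ∈ inversions w := mem_inversions.2 ⟨hlt', lt_of_le_of_ne (not_lt.1 hlt)
      fun h => hlt'.ne' (w.injective h)⟩
    rw [Finset.card_eq_zero] at hm
    simp [hm] at hmem
  | succ m ih =>
    by_cases h : ∀ a b : Fin n, (b : ℕ) = a + 1 → w a < w b
    · rw [eq_one_of_forall_lt h] at hm
      have : inversions (1 : Perm (Fin n)) = ∅ := by
        ext ⟨x, y⟩
        simpa [mem_inversions] using fun h => le_of_lt h
      simp [this] at hm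
    · push Not at h
      obtain ⟨a, b, hab, hle⟩ := h
      have hlt : w b < w a := lt_of_le_of_ne hle fun hh => by
        have := w.injective hh
        rw [Fin.ext_iff] at this
        omega
      obtain ⟨l, hl, hprod, hlen⟩ := ih (w * swap a b)
        (by have := card_inversions_mul_swap_of_gt hab hlt; omega)
      refine ⟨l ++ [swap a b], ?_, ?_, ?_⟩
      · intro s hs
        rcases List.mem_append.1 hs with hs | hs
        · exact hl s hs
        · rw [List.mem_singleton.1 hs]
          exact ⟨a, b, hab, rfl⟩
      · rw [List.prod_append, hprod, List.prod_singleton, mul_assoc, swap_mul_self, mul_one]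
      · simp [hlen]

theorem card_inversions_prod_le (l : List (Perm (Fin n)))
    (hl : ∀ s ∈ l, s ∈ adjTranspositions n) : (inversions l.prod).card ≤ l.length := by
  induction l with
  | nil =>
    have : inversions (1 : Perm (Fin n)) = ∅ := by
      ext ⟨x, y⟩
      simpa [mem_inversions] using fun h => le_of_lt h
    simp [this]
  | cons s l ih =>
    obtain ⟨a, b, hab, rfl⟩ := hl s List.mem_cons_self
    have h1 := ih fun t ht => hl t (List.mem_cons_of_mem _ ht)
    rw [List.prod_cons, List.length_cons]
    rcases lt_trichotomy (l.prod⁻¹ a) (l.prod⁻¹ b) with h | h | h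
    · rw [card_inversions_swap_mul hab h]
      omega
    · have := l.prod⁻¹.injective h
      rw [Fin.ext_iff] at this
      omega
    · have := card_inversions_swap_mul_of_gt hab h
      omega

theorem length_eq_card_inversions (w : Perm (Fin n)) : length w = (inversions w).card := by
  refine le_antisymm (Nat.sInf_le (exists_word w)) ?_
  obtain ⟨l, hl, hprod, hlen⟩ := Nat.sInf_mem (s := {r | ∃ l : List (Perm (Fin n)),
    (∀ s ∈ l, s ∈ adjTranspositions n) ∧ l.prod = w ∧ l.length = r}) ⟨_, exists_word w⟩
  rw [length, ← hlen, ← hprod]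
  exact card_inversions_prod_le l hl

/-! ### Steps that preserve the length -/

/-- Conjugation by an adjacent transposition at which exactly one of `w`, `w⁻¹` ascends. -/
def Exchange (w w' : Perm (Fin n)) : Prop :=
  ∃ a b : Fin n, (b : ℕ) = a + 1 ∧ w' = swap a b * w * swap a b ∧
    (w a < w b ∧ w⁻¹ b < w⁻¹ a ∨ w b < w a ∧ w⁻¹ a < w⁻¹ b)

theorem Exchange.symm {w w' : Perm (Fin n)} (h : Exchange w w') : Exchange w' w := by
  obtain ⟨a, b, hab, rfl, h⟩ := h
  refine ⟨a, b, hab, ?_, ?_⟩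
  · simp [mul_assoc]
  · have key : ∀ v : Perm (Fin n), v b < v a → ∀ u : Perm (Fin n), u a < u b →
        v * u = 1 → swap a b (v b) < swap a b (v a) ∧ swap a b (u a) < swap a b (u b) := by
      intro v hv u hu hvu
      have huv : ∀ x, v (u x) = x := fun x => by rw [← Perm.mul_apply, hvu, Perm.one_apply]
      refine ⟨swap_lt_swap hab hv ?_, swap_lt_swap hab hu ?_⟩
      · rintro ⟨h1, h2⟩
        have h3 : u a = b := v.injective (by rw [huv, h1])
        have h4 : u b = a := v.injective (by rw [huv, h2])
        rw [h3, h4, Fin.lt_def] at hu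
        omega
      · rintro ⟨h1, h2⟩
        have h3 := huv a
        have h4 := huv b
        rw [h1] at h3
        rw [h2] at h4
        rw [h3, h4, Fin.lt_def] at hv
        omega
    simp only [mul_inv_rev, swap_inv, Perm.mul_apply, swap_apply_left, swap_apply_right]
    rcases h with ⟨h1, h2⟩ | ⟨h1, h2⟩
    · exact Or.inr (key w⁻¹ h2 w h1 (by simp)).symm
    · exact Or.inl (key w h1 w⁻¹ h2 (by simp))

/-- Multiplying first on the descending side loses one inversion, and the other multiplication gains
at most one. By symmetry the inequality is an equality. -/
theorem Exchange.length_eq {w w' : Perm (Fin n)} (h : Exchange w w') : length w' = length w := by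
  have key : ∀ w w' : Perm (Fin n), Exchange w w' → length w' ≤ length w := by
    rintro w _ ⟨a, b, hab, rfl, ⟨h1, h2⟩ | ⟨h1, h2⟩⟩
    · have h3 := card_inversions_swap_mul_of_gt hab h2
      rw [length_eq_card_inversions, length_eq_card_inversions]
      rcases lt_trichotomy ((swap a b * w) a) ((swap a b * w) b) with h | h | h
      · rw [card_inversions_mul_swap hab h]
        omega
      · have := (swap a b * w).injective h
        rw [Fin.ext_iff] at this
        omega
      · have := card_inversions_mul_swap_of_gt hab h
        omega
    · have h3 := card_inversions_mul_swap_of_gt hab h1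
      rw [length_eq_card_inversions, length_eq_card_inversions, mul_assoc]
      rcases lt_trichotomy ((w * swap a b)⁻¹ a) ((w * swap a b)⁻¹ b) with h | h | h
      · rw [card_inversions_swap_mul hab h]
        omega
      · have := (w * swap a b)⁻¹.injective h
        rw [Fin.ext_iff] at this
        omega
      · have := card_inversions_swap_mul_of_gt hab h
        omega
  exact le_antisymm (key _ _ h) (key _ _ h.symm)

theorem Exchange.step {w w' : Perm (Fin n)} (h : Exchange w w') : Step w w' := by
  have hl := h.length_eq
  obtain ⟨a, b, hab, rfl, -⟩ := h
  exact ⟨swap a b, ⟨a, b, hab, rfl⟩, rfl, hl.le⟩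

theorem Step.length_le {w w' : Perm (Fin n)} (h : Step w w') : length w' ≤ length w := by
  obtain ⟨_, _, _, h⟩ := h
  exact h

theorem Arrow.length_le {w w' : Perm (Fin n)} (h : Arrow w w') : length w' ≤ length w := by
  induction h with
  | refl => exact le_rfl
  | tail _ h ih => exact h.length_le.trans ih

/-- If `w` and `w⁻¹` both ascend or both descend, the two multiplications change the length in the
same direction, by two in all. The exception is that `w` maps `{a, b}` to itself; then it commutes
with the swap and the step is trivial. -/
theorem Step.eq_or_exchange {w w' : Perm (Fin n)} (h : Step w w') (hl : length w' = length w) :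
    w' = w ∨ Exchange w w' := by
  obtain ⟨_, ⟨a, b, hab, rfl⟩, rfl, -⟩ := h
  have hne : a ≠ b := by rw [Ne, Fin.ext_iff]; omega
  rw [length_eq_card_inversions, length_eq_card_inversions] at hl
  have hfix : w a = a → w b = b → swap a b * w * swap a b = w := by
    intro h1 h2
    rw [mul_assoc, mul_swap_eq_swap_mul, h1, h2, ← mul_assoc, swap_mul_self, one_mul]
  have hfix' : w a = b → w b = a → swap a b * w * swap a b = w := by
    intro h1 h2
    rw [mul_assoc, mul_swap_eq_swap_mul, h1, h2, swap_comm b a, ← mul_assoc, swap_mul_self,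
      one_mul]
  have hw : w a ≠ w b := fun h => hne (w.injective h)
  have hw' : w⁻¹ a ≠ w⁻¹ b := fun h => hne (w⁻¹.injective h)
  rcases lt_or_gt_of_ne hw with h1 | h1 <;> rcases lt_or_gt_of_ne hw' with h2 | h2
  · left
    by_cases hc : w a = a ∧ w b = b
    · exact hfix hc.1 hc.2
    · have h3 := card_inversions_swap_mul hab h2
      have h4 := card_inversions_mul_swap (w := swap a b * w) hab (swap_lt_swap hab h1 hc)
      omega
  · exact Or.inr ⟨a, b, hab, rfl, Or.inl ⟨h1, h2⟩⟩
  · exact Or.inr ⟨a, b, hab, rfl, Or.inr ⟨h1, h2⟩⟩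
  · left
    by_cases hc : w b = a ∧ w a = b
    · exact hfix' hc.2 hc.1
    · have h3 := card_inversions_swap_mul_of_gt hab h2
      have h4 := card_inversions_mul_swap_of_gt (w := swap a b * w) hab (swap_lt_swap hab h1 hc)
      omega

theorem approx_iff_reflTransGen {w w' : Perm (Fin n)} :
    Approx w w' ↔ Relation.ReflTransGen Exchange w w' := by
  constructor
  · rintro ⟨h1, h2⟩
    -- The way back is needed only for this inequality, which forces every step of the way there to
    -- keep the length.
    have hl := Arrow.length_le h2
    clear h2
    induction h1 with
    | refl => exact Relation.ReflTransGen.refl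
    | tail h3 h4 ih =>
      have h5 := Arrow.length_le h3
      have h6 := h4.length_le
      have h7 := ih (by omega)
      rcases h4.eq_or_exchange (by omega) with rfl | h
      · exact h7
      · exact h7.tail h
  · intro h
    induction h with
    | refl => exact ⟨Relation.ReflTransGen.refl, Relation.ReflTransGen.refl⟩
    | tail _ h ih => exact ⟨ih.1.tail h.step, ih.2.head h.symm.step⟩

end Inversions

/-! ### A local description of the hook properties -/

section HookCycle

variable {n p : ℕ} {σ : Perm (Fin n)}

/-- The distance of `x` from the boundary of `[n]`. -/
def depth (x : Fin n) : ℕ := min (x : ℕ) (n - 1 - x)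

theorem depth_rev (x : Fin n) : depth x.rev = depth x := by
  simp only [depth, Fin.val_rev]
  omega

/-- A cycle that contains the `p` smallest and the `p` largest elements and at most one more, that
alternates between small and large elements, and that leaves each of the central intervals at most
once. -/
structure HookCycle (p : ℕ) (σ : Perm (Fin n)) : Prop where
  isCycle : σ.IsCycle
  pos : 1 ≤ p
  le : 2 * p ≤ n
  mid_unique : ∀ x y : Fin n, p ≤ (x : ℕ) → (x : ℕ) + p < n → p ≤ (y : ℕ) → (y : ℕ) + p < n →
    σ x ≠ x → σ y ≠ y → x = y
  lo : ∀ x : Fin n, (x : ℕ) < p → p ≤ (σ x : ℕ)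
  hi : ∀ x : Fin n, n ≤ (x : ℕ) + p → (σ x : ℕ) + p < n
  mid : ∀ x : Fin n, p ≤ (x : ℕ) → (x : ℕ) + p < n → (x < σ x ↔ σ⁻¹ x < x)
  exit_unique : ∀ (j : ℕ) (x y : Fin n), j ≤ depth x → depth (σ x) < j → j ≤ depth y →
    depth (σ y) < j → x = y

theorem perm_apply_inv {α : Type*} (σ : Perm α) (x : α) : σ (σ⁻¹ x) = x := σ.apply_symm_apply x

theorem perm_inv_apply {α : Type*} (σ : Perm α) (x : α) : σ⁻¹ (σ x) = x := σ.symm_apply_apply x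

/-- In contrapositive form: a cycle with moved elements inside and outside a set has an edge that
leaves the set. -/
theorem closed_of_isCycle {α : Type*} [Finite α] {σ : Perm α} (h : σ.IsCycle) {P : α → Prop}
    (hP : ∀ z, P z → P (σ z)) {x y : α} (hx : σ x ≠ x) (hy : σ y ≠ y) (hPx : P x) : P y := by
  obtain ⟨i, rfl⟩ := (h.sameCycle hx hy).exists_nat_pow_eq
  clear hy
  induction i with
  | zero => exact hPx
  | succ i ih =>
    rw [pow_succ', Perm.mul_apply]
    exact hP _ ih

theorem eq_or_eq_of_isCycle {α : Type*} [Finite α] {σ : Perm α} (h : σ.IsCycle) {u v x : α} (hu : σ u = v)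
    (hv : σ v = u) (hne : u ≠ v) (hx : σ x ≠ x) : x = u ∨ x = v := by
  refine closed_of_isCycle h (P := fun z => z = u ∨ z = v) ?_ (x := u) ?_ hx (Or.inl rfl)
  · rintro z (rfl | rfl)
    · exact Or.inr hu
    · exact Or.inl hv
  · rw [hu]
    exact hne.symm

namespace HookCycle

theorem lo_inv (h : HookCycle p σ) (x : Fin n) (hx : (x : ℕ) < p) : p ≤ (σ⁻¹ x : ℕ) := by
  by_contra hlt
  have := h.lo (σ⁻¹ x) (not_le.1 hlt)
  rw [perm_apply_inv] at this
  omega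

theorem hi_inv (h : HookCycle p σ) (x : Fin n) (hx : n ≤ (x : ℕ) + p) :
    (σ⁻¹ x : ℕ) + p < n := by
  by_contra hlt
  have := h.hi (σ⁻¹ x) (not_lt.1 hlt)
  rw [perm_apply_inv] at this
  omega

theorem moved_of_lt (h : HookCycle p σ) {x : Fin n} (hx : (x : ℕ) < p) : σ x ≠ x := by
  intro he
  have := h.lo x hx
  rw [he] at this
  omega

theorem moved_of_ge (h : HookCycle p σ) {x : Fin n} (hx : n ≤ (x : ℕ) + p) : σ x ≠ x := by
  intro he
  have := h.hi x hx
  rw [he] at this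
  omega

/-- As `σ` is a bijection, as many edges enter a central interval as leave it. -/
theorem entry_unique (h : HookCycle p σ) (j : ℕ) (x y : Fin n) (hx : depth x < j)
    (hx' : j ≤ depth (σ x)) (hy : depth y < j) (hy' : j ≤ depth (σ y)) : x = y := by
  classical
  set N : Finset (Fin n) := Finset.univ.filter fun x => j ≤ depth x with hN
  set P : Finset (Fin n) := Finset.univ.filter fun x => j ≤ depth (σ x) with hP
  have hcard : P.card = N.card := by
    refine Finset.card_equiv σ fun i => ?_
    simp [hN, hP]
  have h1 : (N \ P).card ≤ 1 := by
    refine Finset.card_le_one.2 fun u hu v hv => ?_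
    simp only [hN, hP, Finset.mem_sdiff, Finset.mem_filter, Finset.mem_univ, true_and,
      not_le] at hu hv
    exact h.exit_unique j u v hu.1 hu.2 hv.1 hv.2
  rw [← Finset.card_sdiff_comm hcard] at h1
  refine Finset.card_le_one.1 h1 x ?_ y ?_ <;> simp [*]

theorem inv (h : HookCycle p σ) : HookCycle p σ⁻¹ where
  isCycle := h.isCycle.inv
  pos := h.pos
  le := h.le
  mid_unique x y hx hx' hy hy' hxm hym := by
    refine h.mid_unique x y hx hx' hy hy' (fun he => hxm ?_) (fun he => hym ?_) <;>
    rw [Perm.inv_eq_iff_eq, he]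
  lo := h.lo_inv
  hi := h.hi_inv
  mid x hx hx' := by
    have := h.mid x hx hx'
    rw [inv_inv]
    rcases lt_trichotomy (σ⁻¹ x) x with h1 | h1 | h1
    · exact iff_of_false (not_lt_of_gt h1) (not_lt_of_gt (this.2 h1))
    · have h2 : σ x = x := by
        conv_lhs => rw [← h1, perm_apply_inv]
      rw [h1, h2]
    · have h2 : ¬ x < σ x := fun h3 => absurd (this.1 h3) (not_lt_of_gt h1)
      refine ⟨fun _ => lt_of_le_of_ne (not_lt.1 h2) fun h3 => ?_, fun _ => h1⟩
      rw [Perm.inv_eq_iff_eq.2 h3.symm] at h1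
      exact lt_irrefl _ h1
  exit_unique j x y hx hx' hy hy' := by
    refine σ⁻¹.injective (h.entry_unique j _ _ hx' ?_ hy' ?_) <;> simpa

theorem exists_exit (h : HookCycle p σ) {j : ℕ} {x y : Fin n} (hx : σ x ≠ x) (hy : σ y ≠ y)
    (hxj : j ≤ depth x) (hyj : depth y < j) : ∃ z, j ≤ depth z ∧ depth (σ z) < j := by
  by_contra! hcon
  exact absurd (closed_of_isCycle h.isCycle (P := fun z => j ≤ depth z) hcon hx hy hxj)
    (not_le.2 hyj)

theorem exists_entry (h : HookCycle p σ) {j : ℕ} {x y : Fin n} (hx : σ x ≠ x) (hy : σ y ≠ y)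
    (hxj : j ≤ depth x) (hyj : depth y < j) : ∃ z, depth z < j ∧ j ≤ depth (σ z) := by
  by_contra! hcon
  exact absurd (closed_of_isCycle h.isCycle (P := fun z => depth z < j) hcon hy hx hyj)
    (not_lt.2 hxj)

/-- The edges by which a central interval is entered and left are both ascents or both descents. -/
theorem exit_lt_iff_entry_lt (h : HookCycle p σ) {j : ℕ} {z y : Fin n} (hz : j ≤ depth z)
    (hz' : depth (σ z) < j) (hy : depth y < j) (hy' : j ≤ depth (σ y)) :
    z < σ z ↔ y < σ y := by
  classical
  -- `g` marks ascending edges, and `f x` compares the edge out of `x` with the edge into `x`. Small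
  -- elements are local minima of the cycle, large ones local maxima, and middle ones are passed
  -- monotonically or fixed. So `f` is odd under reflection and sums to zero over the symmetric set
  -- `N`. Telescoping turns that sum into the difference of `g` at the exit and at the entry.
  set g : Fin n → ℤ := fun x => if x < σ x then 1 else 0 with hg
  set f : Fin n → ℤ := fun x => g x - g (σ⁻¹ x) with hf
  have hfval : ∀ x : Fin n,
      f x = if (x : ℕ) < p then 1 else if n ≤ (x : ℕ) + p then -1 else 0 := by
    intro x
    have h1 := h.le
    have h2 := h.lo x
    have h3 := h.hi x
    have h4 := h.lo_inv x
    have h5 := h.hi_inv x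
    have h6 := h.mid x
    simp only [Fin.lt_def] at h6
    simp only [hf, hg, perm_apply_inv, Fin.lt_def]
    split_ifs <;> first | rfl | omega
  have hfrev : ∀ x, f x.rev = - f x := by
    intro x
    have h1 := h.le
    rw [hfval, hfval, Fin.val_rev]
    split_ifs <;> first | rfl | omega
  set N : Finset (Fin n) := Finset.univ.filter fun x => j ≤ depth x with hN
  set P : Finset (Fin n) := Finset.univ.filter fun x => j ≤ depth (σ x) with hP
  have hsum : ∑ x ∈ N, f x = 0 := by
    have h1 : ∑ x ∈ N, f x = ∑ x ∈ N, - f x :=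
      Finset.sum_equiv Fin.revPerm (by simp [hN, depth_rev]) (by simp [hfrev])
    rw [Finset.sum_neg_distrib] at h1
    omega
  have hNP : ∑ x ∈ N, g x = ∑ x ∈ P, g x := by
    have h1 : ∑ x ∈ P, g x = ∑ x ∈ N, g (σ⁻¹ x) :=
      Finset.sum_equiv σ (by simp [hN, hP]) (by simp)
    simp only [hf, Finset.sum_sub_distrib] at hsum
    omega
  have hz1 : N \ P = {z} := by
    ext u
    simp only [hN, hP, Finset.mem_sdiff, Finset.mem_filter, Finset.mem_univ, true_and, not_le,
      Finset.mem_singleton]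
    exact ⟨fun hu => h.exit_unique j u z hu.1 hu.2 hz hz', by rintro rfl; exact ⟨hz, hz'⟩⟩
  have hy1 : P \ N = {y} := by
    ext u
    simp only [hN, hP, Finset.mem_sdiff, Finset.mem_filter, Finset.mem_univ, true_and, not_le,
      Finset.mem_singleton]
    exact ⟨fun hu => h.entry_unique j u y hu.2 hu.1 hy hy', by rintro rfl; exact ⟨hy', hy⟩⟩
  have h1 := Finset.sum_inter_add_sum_sdiff N P g
  have h2 := Finset.sum_inter_add_sum_sdiff P N g
  rw [hz1, Finset.sum_singleton] at h1
  rw [hy1, Finset.sum_singleton, Finset.inter_comm] at h2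
  have h3 : g z = g y := by omega
  simp only [hg] at h3
  split_ifs at h3 with h4 h5 h5
  · exact iff_of_true h4 h5
  · omega
  · omega
  · exact iff_of_false h4 h5

/-- Reflection turns statements about small elements into statements about large ones. It reverses
both inequalities of `mid`, so that field comes from the inverse. -/
theorem rev (h : HookCycle p σ) : HookCycle p (Fin.revPerm * σ * Fin.revPerm) where
  isCycle := by
    have := h.isCycle.conj (g := Fin.revPerm)
    rwa [show (Fin.revPerm : Perm (Fin n))⁻¹ = Fin.revPerm from Fin.revPerm_symm] at this
  pos := h.pos
  le := h.le
  mid_unique x y hx hx' hy hy' hxm hym := by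
    refine Fin.rev_injective (h.mid_unique x.rev y.rev ?_ ?_ ?_ ?_ ?_ ?_)
    · rw [Fin.val_rev]; omega
    · rw [Fin.val_rev]; omega
    · rw [Fin.val_rev]; omega
    · rw [Fin.val_rev]; omega
    · intro he
      exact hxm (by simp [he])
    · intro he
      exact hym (by simp [he])
  lo x hx := by
    have := h.hi x.rev (by rw [Fin.val_rev]; omega)
    simp only [Perm.mul_apply, Fin.revPerm_apply, Fin.val_rev]
    omega
  hi x hx := by
    have := h.lo x.rev (by rw [Fin.val_rev]; omega)
    simp only [Perm.mul_apply, Fin.revPerm_apply, Fin.val_rev]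
    have := (σ x.rev).isLt
    omega
  mid x hx hx' := by
    have := h.inv.mid x.rev (by rw [Fin.val_rev]; omega) (by rw [Fin.val_rev]; omega)
    rw [show (Fin.revPerm * σ * Fin.revPerm : Perm (Fin n))⁻¹ =
      Fin.revPerm * σ⁻¹ * Fin.revPerm by
        rw [mul_inv_rev, mul_inv_rev,
          show (Fin.revPerm : Perm (Fin n))⁻¹ = Fin.revPerm from Fin.revPerm_symm, mul_assoc]]
    simp only [Perm.mul_apply, Fin.revPerm_apply]
    rw [Fin.lt_rev_iff, Fin.rev_lt_iff, ← this.symm, inv_inv]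
  exit_unique j x y hx hx' hy hy' := by
    simp only [Perm.mul_apply, Fin.revPerm_apply, depth_rev] at hx' hy'
    exact Fin.rev_injective (h.exit_unique j x.rev y.rev (by rwa [depth_rev]) hx'
      (by rwa [depth_rev]) hy')

end HookCycle

end HookCycle

/-! ### Invariance under exchanges -/

section Exchange

variable {n p : ℕ} {σ : Perm (Fin n)}

theorem swap_conj_inv (s σ : Perm (Fin n)) (hs : s⁻¹ = s) : (s * σ * s)⁻¹ = s * σ⁻¹ * s := by
  rw [mul_inv_rev, mul_inv_rev, hs, mul_assoc]

namespace HookCycle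

/-- At an ascent `a, a + 1` of small elements the central interval that starts with `a + 1` is
entered from `a` and left from `a + 1`. -/
theorem ascent_lo (h : HookCycle p σ) {a b : Fin n} (hab : (b : ℕ) = a + 1) (hb : (b : ℕ) < p)
    (hlt : σ a < σ b) :
    (b : ℕ) ≤ depth (σ a) ∧ depth (σ b) < (b : ℕ) ∧ (b : ℕ) ≤ depth (σ⁻¹ b) ∧
      depth (σ⁻¹ a) < (b : ℕ) := by
  have hle := h.le
  have hane : a ≠ b := by rw [Ne, Fin.ext_iff]; omega
  have hla := h.lo a (by omega)
  have hlb := h.lo b hb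
  have hia := h.lo_inv a (by omega)
  have hib := h.lo_inv b hb
  have hma := h.moved_of_lt (x := a) (by omega)
  have hmb := h.moved_of_lt hb
  have hda : depth a = a := by simp only [depth]; omega
  have hdb : depth b = b := by simp only [depth]; omega
  have hsa := (σ a).isLt
  have hsb := (σ b).isLt
  rw [Fin.lt_def] at hlt
  -- Level `j` stands for the elements of depth at least `j`. If this fails, `b` leaves level `a`,
  -- so `σ a` is the mirror image of `a`, or else `a` would leave that level too. The edge out of
  -- the mirror image then enters level `b` downwards, while `b` leaves it upwards.
  have h1 : (b : ℕ) ≤ depth (σ a) := by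
    by_contra hna
    have hea : depth (σ b) < (a : ℕ) := by simp only [depth] at *; omega
    have hda' : depth (σ a) = a := by
      by_contra hne
      exact hane (h.exit_unique a a b (by omega) (by omega) (by omega) hea)
    have hval : (σ a : ℕ) = n - 1 - a := by simp only [depth] at *; omega
    have hla' := h.hi (σ a) (by omega)
    have h2 : (a : ℕ) ≤ depth (σ (σ a)) := by
      by_contra hlt2
      have := h.exit_unique a (σ a) b (by omega) (by omega) (by omega) hea
      rw [Fin.ext_iff] at this
      omega
    have h3 : σ (σ a) ≠ a := by
      intro h3
      rcases eq_or_eq_of_isCycle h.isCycle rfl h3 hma.symm hmb with h4 | h4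
      · exact hane h4.symm
      · rw [Fin.ext_iff] at h4
        omega
    rw [Ne, Fin.ext_iff] at h3
    have h4 := h.exit_lt_iff_entry_lt (j := b) (z := b) (y := σ a) (by omega) (by omega) (by omega)
      (by simp only [depth] at *; omega)
    rw [Fin.lt_def, Fin.lt_def] at h4
    omega
  -- Otherwise `σ b` is the mirror image of `b`, since `a` and `b` cannot both enter level `b + 1`.
  -- The exit `z` of that level ascends like its entry at `a`, and it cannot end at `σ b`, so it
  -- leaves level `b` as well. The mirror image of `b` is then forced into level `b + 1`, whose only
  -- entry is at `a`.
  have h2 : depth (σ b) < (b : ℕ) := by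
    by_contra hnb
    have hea : (b : ℕ) + 1 ≤ depth (σ a) := by simp only [depth] at *; omega
    have hdb' : depth (σ b) = b := by
      by_contra hne
      exact hane (h.entry_unique (b + 1) a b (by omega) (by omega) (by omega) (by omega))
    have hval : (σ b : ℕ) = n - 1 - b := by simp only [depth] at *; omega
    obtain ⟨z, hz, hz'⟩ := h.exists_exit (j := b + 1) (x := σ a) (y := a)
      (fun he => hma (σ.injective he)) hma hea (by omega)
    have hk := h.exit_lt_iff_entry_lt hz hz' (y := a) (by omega) hea
    rw [Fin.lt_def, Fin.lt_def] at hk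
    have hzb : σ z ≠ σ b := fun he => by
      rw [σ.injective he] at hz
      omega
    have hz2 : depth (σ z) < (b : ℕ) := by
      rw [Ne, Fin.ext_iff] at hzb
      simp only [depth] at *
      omega
    have h3 : (b : ℕ) ≤ depth (σ (σ b)) := by
      by_contra hlt2
      have := h.exit_unique b (σ b) z (by omega) (by omega) (by omega) hz2
      rw [← this] at hz
      omega
    have h4 : σ (σ b) ≠ b := by
      intro h4
      rcases eq_or_eq_of_isCycle h.isCycle rfl h4 hmb.symm hma with h5 | h5
      · exact hane h5
      · rw [Fin.ext_iff] at h5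
        omega
    have h5 : σ (σ b) ≠ σ b := fun h5 => hmb (σ.injective h5)
    rw [Ne, Fin.ext_iff] at h4 h5
    have := h.entry_unique (b + 1) a (σ b) (by omega) hea (by omega)
      (by simp only [depth] at *; omega)
    rw [Fin.ext_iff] at this
    omega
  -- Now `a` enters level `b` and `b` leaves it, so `σ⁻¹ b` cannot be a second entry nor `σ⁻¹ a` a
  -- second exit.
  refine ⟨h1, h2, ?_, ?_⟩
  · by_contra hlt2
    have := h.entry_unique b a (σ⁻¹ b) (by omega) h1 (by omega) (by rw [perm_apply_inv]; omega)
    rw [Fin.ext_iff] at this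
    omega
  · by_contra hlt2
    have := h.exit_unique b b (σ⁻¹ a) (by omega) h2 (by omega) (by rw [perm_apply_inv]; omega)
    rw [Fin.ext_iff] at this
    omega

theorem isCycle_conj_swap (h : HookCycle p σ) (a b : Fin n) :
    (swap a b * σ * swap a b).IsCycle := by
  have := h.isCycle.conj (g := swap a b)
  rwa [swap_inv] at this

theorem swap_val_lo {a b x : Fin n} {m : ℕ} (ha : (a : ℕ) < m) (hb : (b : ℕ) < m) :
    ((swap a b x : Fin n) : ℕ) < m ↔ (x : ℕ) < m := by
  rw [swap_apply_def]
  split_ifs with h1 h2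
  · subst h1; simp [ha, hb]
  · subst h2; simp [ha, hb]
  · rfl

theorem swap_of_val_ne {a b x : Fin n} (ha : (x : ℕ) ≠ a) (hb : (x : ℕ) ≠ b) : swap a b x = x :=
  swap_apply_of_ne_of_ne (fun h => ha (by rw [h])) (fun h => hb (by rw [h]))

theorem depth_swap {a b x : Fin n} {j : ℕ} (hab : (b : ℕ) = a + 1) (hb : 2 * (b : ℕ) < n)
    (hj : j ≠ b) : j ≤ depth (swap a b x) ↔ j ≤ depth x := by
  simp only [swap_apply_def, depth]
  split_ifs with h1 h2
  · subst h1; omega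
  · subst h2; omega
  · rfl

/-- Swapping the depths `a` and `b` affects no level except level `b`. There, by `ascent_lo`, the
edge out of `a` becomes internal and the edge out of `b` external, while the edge into `b` becomes
the exit and the edge into `a` the entry. -/
theorem conj_lo (h : HookCycle p σ) {a b : Fin n} (hab : (b : ℕ) = a + 1) (hb : (b : ℕ) < p)
    (hlt : σ a < σ b) : HookCycle p (swap a b * σ * swap a b) := by
  have hle := h.le
  have hap : (a : ℕ) < p := by omega
  have hsp : ∀ x : Fin n, ((swap a b x : Fin n) : ℕ) < p ↔ (x : ℕ) < p :=
    fun x => swap_val_lo hap hb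
  have hfix : ∀ x : Fin n, p ≤ (x : ℕ) → swap a b x = x :=
    fun x hx => swap_of_val_ne (by omega) (by omega)
  have hfix2 : ∀ x : Fin n, p ≤ (x : ℕ) → ∀ y, swap a b y = x ↔ y = x := fun x hx y => by
    rw [swap_apply_eq_iff, hfix x hx]
  refine ⟨h.isCycle_conj_swap a b, h.pos, hle, ?_, ?_, ?_, ?_, ?_⟩
  · intro x y hx hx' hy hy' hxm hym
    simp only [Perm.mul_apply, hfix x hx, hfix y hy, ne_eq, hfix2 x hx, hfix2 y hy] at hxm hym
    exact h.mid_unique x y hx hx' hy hy' hxm hym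
  · intro x hx
    have h1 := h.lo _ ((hsp x).2 hx)
    rw [Perm.mul_apply, Perm.mul_apply, hfix _ h1]
    exact h1
  · intro x hx
    have h1 := h.hi x hx
    have h2 := hsp (σ x)
    rw [Perm.mul_apply, Perm.mul_apply, hfix x (by omega)]
    by_cases h3 : (σ x : ℕ) < p
    · have := h2.2 h3
      omega
    · rwa [hfix _ (not_lt.1 h3)]
  · intro x hx hx'
    have key : ∀ y : Fin n, (swap a b y < x ↔ y < x) ∧ (x < swap a b y ↔ x < y) := by
      intro y
      have h2 := hsp y
      by_cases h3 : (y : ℕ) < p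
      · rw [Fin.lt_def, Fin.lt_def, Fin.lt_def, Fin.lt_def]
        omega
      · rw [hfix y (by omega)]
        exact ⟨Iff.rfl, Iff.rfl⟩
    rw [swap_conj_inv _ _ (swap_inv a b)]
    simp only [Perm.mul_apply, hfix x hx]
    rw [(key _).1, (key _).2]
    exact h.mid x hx hx'
  · intro j x y hx hx' hy hy'
    obtain ⟨h1, h2, -, -⟩ := h.ascent_lo hab hb hlt
    by_cases hj : j = b
    · subst hj
      have hdb : depth b = b := by simp only [depth]; omega
      have hda : depth a = a := by simp only [depth]; omega
      have key : ∀ x : Fin n, (b : ℕ) ≤ depth x →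
          depth ((swap a b * σ * swap a b) x) < (b : ℕ) → σ (swap a b x) = b := by
        intro x hx hx'
        rw [Perm.mul_apply, Perm.mul_apply] at hx'
        by_cases hxb : x = b
        · rw [hxb, swap_apply_right] at hx' ⊢
          by_contra hne
          have : σ a ≠ a := h.moved_of_lt hap
          rw [swap_apply_of_ne_of_ne this hne] at hx'
          omega
        · have hxa : x ≠ a := fun he => by
            rw [he] at hx
            omega
          rw [swap_apply_of_ne_of_ne hxa hxb] at hx' ⊢
          by_contra hne
          by_cases hsa : σ x = a
          · rw [hsa, swap_apply_left] at hx'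
            omega
          · rw [swap_apply_of_ne_of_ne hsa hne] at hx'
            exact hxb (h.exit_unique b x b hx hx' (by omega) h2)
      exact (swap a b).injective (σ.injective ((key x hx hx').trans (key y hy hy').symm))
    · have hsd : ∀ x : Fin n, j ≤ depth (swap a b x) ↔ j ≤ depth x :=
        fun x => depth_swap hab (by omega) hj
      have hsd' : ∀ x : Fin n, depth (swap a b x) < j ↔ depth x < j :=
        fun x => by rw [← not_le, hsd, not_le]
      rw [Perm.mul_apply, Perm.mul_apply, hsd'] at hx' hy'
      exact (swap a b).injective
        (h.exit_unique j _ _ ((hsd x).2 hx) hx' ((hsd y).2 hy) hy')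

/-- An ascent between the largest small element `a` and `a + 1` is an edge from `a` to the middle
element `a + 1`. -/
theorem ascent_boundary (h : HookCycle p σ) {a b : Fin n} (hab : (b : ℕ) = a + 1)
    (hb : (b : ℕ) = p) (hlt : σ a < σ b) : (b : ℕ) + p < n ∧ σ a = b ∧ n ≤ (σ b : ℕ) + p := by
  have hle := h.le
  have hane : a ≠ b := by rw [Ne, Fin.ext_iff]; omega
  have hla := h.lo a (by omega)
  have hma := h.moved_of_lt (x := a) (by omega)
  have hda : depth a = a := by simp only [depth]; omega
  have hsa := (σ a).isLt
  have hsb := (σ b).isLt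
  rw [Fin.lt_def] at hlt
  have hbn : (b : ℕ) + p < n := by
    by_contra hge
    have := h.hi b (by omega)
    omega
  have hmb : σ b ≠ b := by
    rw [Ne, Fin.ext_iff]
    omega
  have hbl : n ≤ (σ b : ℕ) + p := by
    by_contra hlt2
    exact hmb (h.mid_unique (σ b) b (by omega) (by omega) (by omega) hbn
      (fun he => hmb (σ.injective he)) hmb)
  refine ⟨hbn, ?_, hbl⟩
  -- If `σ a ≠ b`, then `σ a` is large, and it is the mirror image of `a` because `b` already leaves
  -- level `a`. Its successor can only be `b`, which is then entered by a descent and left by an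
  -- ascent, against `mid`.
  by_contra hne
  have hal : n ≤ (σ a : ℕ) + p := by
    by_contra hlt2
    exact hne (h.mid_unique (σ a) b (by omega) (by omega) (by omega) hbn
      (fun he => hma (σ.injective he)) hmb)
  have hbe : depth (σ b) < (a : ℕ) := by simp only [depth] at *; omega
  have hdb : (a : ℕ) ≤ depth b := by simp only [depth] at *; omega
  have hda' : depth (σ a) = a := by
    by_contra hne
    exact hane (h.exit_unique a a b (by omega) (by simp only [depth] at *; omega) hdb hbe)
  have hval : (σ a : ℕ) = n - 1 - a := by simp only [depth] at *; omega
  have hla' := h.hi (σ a) hal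
  have h2 : (a : ℕ) ≤ depth (σ (σ a)) := by
    by_contra hlt2
    have := h.exit_unique a (σ a) b (by omega) (by omega) (by omega) hbe
    rw [Fin.ext_iff] at this
    omega
  have h3 : σ (σ a) ≠ a := by
    intro h3
    rcases eq_or_eq_of_isCycle h.isCycle rfl h3 hma.symm hmb with h4 | h4
    · exact hane h4.symm
    · rw [Fin.ext_iff] at h4
      omega
  have h4 : σ (σ a) = b := by
    rw [Ne, Fin.ext_iff] at h3
    refine h.mid_unique _ b (by simp only [depth] at *; omega) (by simp only [depth] at *; omega)
      (by omega) hbn (fun he => hma (σ.injective (σ.injective he))) hmb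
  have h5 := (h.mid b (by omega) hbn).1 (by rw [Fin.lt_def]; omega)
  rw [← h4, perm_inv_apply, h4, Fin.lt_def] at h5
  omega

/-- The path `σ⁻¹ a → a → b → σ b` becomes `σ⁻¹ a → b → a → σ b`: the middle element, passed upwards
before, is now passed downwards. -/
theorem conj_boundary (h : HookCycle p σ) {a b : Fin n} (hab : (b : ℕ) = a + 1)
    (hb : (b : ℕ) = p) (hlt : σ a < σ b) : HookCycle p (swap a b * σ * swap a b) := by
  have hle := h.le
  have hpos := h.pos
  obtain ⟨hbn, hsab, hbl⟩ := h.ascent_boundary hab hb hlt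
  have hmb : σ b ≠ b := by
    intro he
    rw [he] at hbl
    omega
  have hfix : ∀ x : Fin n, (x : ℕ) ≠ a → (x : ℕ) ≠ p → swap a b x = x :=
    fun x hx hx' => swap_of_val_ne hx (by omega)
  have hmidfix : ∀ x : Fin n, p ≤ (x : ℕ) → (x : ℕ) + p < n → x ≠ b → σ x = x := by
    intro x hx hx' hxb
    by_contra hxm
    exact hxb (h.mid_unique x b hx hx' (by omega) hbn hxm hmb)
  have hmid' : ∀ x : Fin n, p ≤ (x : ℕ) → (x : ℕ) + p < n → x ≠ b →
      (swap a b * σ * swap a b) x = x := by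
    intro x hx hx' hxb
    have hxb' := hxb
    rw [Ne, Fin.ext_iff] at hxb'
    have h1 := hfix x (by omega) (by omega)
    rw [Perm.mul_apply, Perm.mul_apply, h1, hmidfix x hx hx' hxb, h1]
  have hσb : (swap a b * σ * swap a b) b = a := by simp [hsab]
  refine ⟨h.isCycle_conj_swap a b, hpos, hle, ?_, ?_, ?_, ?_, ?_⟩
  · intro x y hx hx' hy hy' hxm hym
    have h1 : x = b := by
      by_contra hne
      exact hxm (hmid' x hx hx' hne)
    have h2 : y = b := by
      by_contra hne
      exact hym (hmid' y hy hy' hne)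
    rw [h1, h2]
  · intro x hx
    rw [Perm.mul_apply, Perm.mul_apply]
    by_cases hxa : x = a
    · rw [hxa, swap_apply_left, hfix _ (by omega) (by omega)]
      omega
    · rw [hfix x (fun he => hxa (Fin.ext he)) (by omega)]
      have h1 := h.lo x hx
      rw [hfix _ (by omega)]
      · exact h1
      · intro he
        exact hxa (σ.injective (by rw [hsab, Fin.ext_iff, he, hb]))
  · intro x hx
    have h1 := h.hi x hx
    rw [Perm.mul_apply, Perm.mul_apply, hfix x (by omega) (by omega), swap_apply_def]
    split_ifs <;> omega
  · intro x hx hx'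
    by_cases hxb : x = b
    · subst hxb
      rw [swap_conj_inv _ _ (swap_inv a x), hσb, Perm.mul_apply, Perm.mul_apply, swap_apply_right]
      have h1 := h.lo_inv a (by omega)
      have h2 : (σ⁻¹ a : ℕ) ≠ p := by
        intro he
        have h3 : σ⁻¹ a = x := Fin.ext (by rw [he, hb])
        rw [Perm.inv_eq_iff_eq] at h3
        rw [← h3] at hbl
        omega
      rw [hfix _ (by omega) h2]
      simp only [Fin.lt_def]
      omega
    · rw [Perm.inv_eq_iff_eq.2 (hmid' x hx hx' hxb).symm, hmid' x hx hx' hxb]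
  · intro j x y hx hx' hy hy'
    by_cases hj : j < p
    · have hsd : ∀ x : Fin n, j ≤ depth (swap a b x) ↔ j ≤ depth x :=
        fun x => depth_swap hab (by omega) (by omega)
      have hsd' : ∀ x : Fin n, depth (swap a b x) < j ↔ depth x < j :=
        fun x => by rw [← not_le, hsd, not_le]
      rw [Perm.mul_apply, Perm.mul_apply, hsd'] at hx' hy'
      exact (swap a b).injective
        (h.exit_unique j _ _ ((hsd x).2 hx) hx' ((hsd y).2 hy) hy')
    · have key : ∀ x : Fin n, j ≤ depth x → depth ((swap a b * σ * swap a b) x) < j → x = b := by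
        intro x hx hx'
        by_contra hne
        rw [hmid' x (by simp only [depth] at hx; omega) ?_ hne] at hx'
        · omega
        · have := x.isLt
          simp only [depth] at hx
          omega
      rw [key x hx hx', key y hy hy']

/-- At most one middle element is moved, and its exact place among the middle ones does not matter,
so no ascent is required. -/
theorem conj_mid (h : HookCycle p σ) {a b : Fin n} (hab : (b : ℕ) = a + 1) (ha : p ≤ (a : ℕ))
    (hb : (b : ℕ) + p < n) : HookCycle p (swap a b * σ * swap a b) := by
  have hle := h.le
  have hpos := h.pos
  have hfix : ∀ x : Fin n, (x : ℕ) < p ∨ n ≤ (x : ℕ) + p → swap a b x = x :=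
    fun x hx => swap_of_val_ne (by omega) (by omega)
  have hmem : ∀ x : Fin n, (p ≤ ((swap a b x : Fin n) : ℕ) ∧ ((swap a b x : Fin n) : ℕ) + p < n) ↔
      (p ≤ (x : ℕ) ∧ (x : ℕ) + p < n) := by
    intro x
    rw [swap_apply_def]
    split_ifs with h1 h2
    · subst h1; omega
    · subst h2; omega
    · rfl
  refine ⟨h.isCycle_conj_swap a b, hpos, hle, ?_, ?_, ?_, ?_, ?_⟩
  · intro x y hx hx' hy hy' hxm hym
    have h1 := (hmem x).2 ⟨hx, hx'⟩
    have h2 := (hmem y).2 ⟨hy, hy'⟩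
    refine (swap a b).injective (h.mid_unique _ _ h1.1 h1.2 h2.1 h2.2 (fun he => hxm ?_)
      (fun he => hym ?_)) <;> simp [he]
  · intro x hx
    have h1 := h.lo x hx
    rw [Perm.mul_apply, Perm.mul_apply, hfix x (Or.inl hx)]
    have h2 := hmem (σ x)
    by_cases h3 : n ≤ (σ x : ℕ) + p
    · rwa [hfix _ (Or.inr h3)]
    · omega
  · intro x hx
    have h1 := h.hi x hx
    rw [Perm.mul_apply, Perm.mul_apply, hfix x (Or.inr hx)]
    have h2 := hmem (σ x)
    by_cases h3 : (σ x : ℕ) < p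
    · rwa [hfix _ (Or.inl h3)]
    · omega
  · intro x hx hx'
    obtain ⟨h1, h2⟩ := (hmem x).2 ⟨hx, hx'⟩
    have h3 := h.mid _ h1 h2
    rw [swap_conj_inv _ _ (swap_inv a b), Perm.mul_apply, Perm.mul_apply, Perm.mul_apply,
      Perm.mul_apply]
    by_cases hm : σ (swap a b x) = swap a b x
    · rw [Perm.inv_eq_iff_eq.2 hm.symm, hm, swap_apply_self]
    · have h4 : ∀ y : Fin n, σ y ≠ y → y ≠ swap a b x → (y : ℕ) < p ∨ n ≤ (y : ℕ) + p := by
        intro y hy hne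
        by_contra! hcon
        exact hne (h.mid_unique y _ hcon.1 hcon.2 h1 h2 hy hm)
      have h5 := h4 _ (fun he => hm (σ.injective he)) hm
      have h6 := h4 (σ⁻¹ (swap a b x)) (fun he => hm ?_) (fun he => hm ?_)
      · rw [hfix _ h5, hfix _ h6]
        simp only [Fin.lt_def] at *
        omega
      · rw [perm_apply_inv] at he
        conv_lhs => rw [he, perm_apply_inv]
      · rw [Perm.inv_eq_iff_eq] at he
        exact he.symm
  · intro j x y hx hx' hy hy'
    by_cases hj : j ≤ p
    · have hsd : ∀ x : Fin n, j ≤ depth (swap a b x) ↔ j ≤ depth x := by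
        intro x
        simp only [swap_apply_def, depth]
        split_ifs with h1 h2
        · subst h1; omega
        · subst h2; omega
        · rfl
      have hsd' : ∀ x : Fin n, depth (swap a b x) < j ↔ depth x < j :=
        fun x => by rw [← not_le, hsd, not_le]
      rw [Perm.mul_apply, Perm.mul_apply, hsd'] at hx' hy'
      exact (swap a b).injective
        (h.exit_unique j _ _ ((hsd x).2 hx) hx' ((hsd y).2 hy) hy')
    · have h1 : p ≤ ((swap a b x : Fin n) : ℕ) ∧ ((swap a b x : Fin n) : ℕ) + p < n := by
        rw [hmem]; simp only [depth] at hx; omega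
      have h2 : p ≤ ((swap a b y : Fin n) : ℕ) ∧ ((swap a b y : Fin n) : ℕ) + p < n := by
        rw [hmem]; simp only [depth] at hy; omega
      refine (swap a b).injective (h.mid_unique _ _ h1.1 h1.2 h2.1 h2.2 (fun he => ?_)
        (fun he => ?_))
      · rw [Perm.mul_apply, Perm.mul_apply, he, swap_apply_self] at hx'
        omega
      · rw [Perm.mul_apply, Perm.mul_apply, he, swap_apply_self] at hy'
        omega

theorem conj_of_lt (h : HookCycle p σ) {a b : Fin n} (hab : (b : ℕ) = a + 1)
    (hbn : (b : ℕ) + p < n ∨ (b : ℕ) ≤ p) (hlt : σ a < σ b) :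
    HookCycle p (swap a b * σ * swap a b) := by
  rcases lt_trichotomy (b : ℕ) p with hb | hb | hb
  · exact h.conj_lo hab hb hlt
  · exact h.conj_boundary hab hb hlt
  · exact h.conj_mid hab (by omega) (by omega)

theorem rev_conj_swap (σ : Perm (Fin n)) (a b : Fin n) :
    Fin.revPerm * (swap b.rev a.rev * (Fin.revPerm * σ * Fin.revPerm) * swap b.rev a.rev) *
      Fin.revPerm = swap a b * σ * swap a b := by
  have h1 : ∀ x, (swap b.rev a.rev x.rev).rev = swap a b x := by
    intro x
    rw [swap_comm, swap_apply_def, swap_apply_def]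
    simp only [Fin.rev_inj]
    split_ifs <;> simp
  ext x
  simp only [Perm.mul_apply, Fin.revPerm_apply, h1]

/-- Conjugation at an ascent. -/
theorem conj_ascent (h : HookCycle p σ) {a b : Fin n} (hab : (b : ℕ) = a + 1) (hlt : σ a < σ b) :
    HookCycle p (swap a b * σ * swap a b) := by
  by_cases hbn : (b : ℕ) + p < n ∨ (b : ℕ) ≤ p
  · exact h.conj_of_lt hab hbn hlt
  · have hle := h.le
    have hbl := b.isLt
    have h1 := h.rev.conj_of_lt (a := b.rev) (b := a.rev) ?_ ?_ ?_
    · have h2 := h1.rev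
      rwa [rev_conj_swap] at h2
    · simp only [Fin.val_rev]
      omega
    · simp only [Fin.val_rev]
      omega
    · simpa using hlt

theorem exchange (h : HookCycle p σ) {τ : Perm (Fin n)} (he : Exchange σ τ) : HookCycle p τ := by
  obtain ⟨a, b, hab, rfl, ⟨h1, -⟩ | ⟨-, h1⟩⟩ := he
  · exact h.conj_ascent hab h1
  · have := (h.inv.conj_ascent hab h1).inv
    rwa [swap_conj_inv _ _ (swap_inv a b), inv_inv] at this

end HookCycle

end Exchange

/-! ### A potential that decreases at exchanges -/

section Potential

variable {n p : ℕ} {σ : Perm (Fin n)}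

/-- The contribution of an edge from depth `u` to depth `v` to the potential. -/
def crossing (u v : ℕ) : ℤ := if v < u then v else if u < v then -u else 0

theorem crossing_of_gt {u v : ℕ} (h : v < u) : crossing u v = v := if_pos h

theorem crossing_of_lt {u v : ℕ} (h : u < v) : crossing u v = -u := by
  rw [crossing, if_neg (not_lt_of_gt h), if_pos h]

theorem crossing_self (u : ℕ) : crossing u u = 0 := by
  simp [crossing]

/-- The sum of the contributions of all the edges of `σ`. -/
def potential (σ : Perm (Fin n)) : ℤ := ∑ x, crossing (depth x) (depth (σ x))

theorem neg_le_potential (σ : Perm (Fin n)) : -((n : ℤ) * n) ≤ potential σ := by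
  have h1 : ∑ _x : Fin n, -(n : ℤ) ≤ potential σ := by
    refine Finset.sum_le_sum fun x _ => ?_
    have h2 : depth x ≤ n := by
      have := x.isLt
      simp only [depth]
      omega
    simp only [crossing]
    split_ifs <;> omega
  simpa using h1

theorem potential_rev (σ : Perm (Fin n)) :
    potential (Fin.revPerm * σ * Fin.revPerm) = potential σ :=
  Fintype.sum_equiv Fin.revPerm _ _ fun x => by simp [depth_rev]

/-- Only the edges that start or end at `a` or `b` contribute; the inequalities make their four
sources distinct. -/
theorem potential_conj_swap (σ : Perm (Fin n)) {a b c d : Fin n} (hc : σ c = a) (hd : σ d = b)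
    (hab : a ≠ b) (hac : a ≠ c) (had : a ≠ d) (hbc : b ≠ c) (hbd : b ≠ d) :
    potential (swap a b * σ * swap a b) - potential σ =
      crossing (depth b) (depth (σ a)) - crossing (depth a) (depth (σ a)) +
      (crossing (depth a) (depth (σ b)) - crossing (depth b) (depth (σ b))) +
      (crossing (depth c) (depth b) - crossing (depth c) (depth a)) +
      (crossing (depth d) (depth a) - crossing (depth d) (depth b)) := by
  have hcd : c ≠ d := fun h => hab (by rw [← hc, ← hd, h])
  have h1 : potential (swap a b * σ * swap a b) =
      ∑ x, crossing (depth (swap a b x)) (depth (swap a b (σ x))) :=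
    Fintype.sum_equiv (swap a b) _ _ fun x => by simp
  rw [h1, potential, ← Finset.sum_sub_distrib,
    ← Finset.sum_subset (Finset.subset_univ ({a, b, c, d} : Finset (Fin n)))]
  · have hσ : ∀ x, x ≠ c → x ≠ d → swap a b (σ x) = σ x := fun x hxc hxd =>
      swap_apply_of_ne_of_ne (fun h => hxc (σ.injective (h.trans hc.symm)))
        (fun h => hxd (σ.injective (h.trans hd.symm)))
    rw [Finset.sum_insert (by simp [hab, hac, had]), Finset.sum_insert (by simp [hbc, hbd]),
      Finset.sum_insert (by simpa using hcd), Finset.sum_singleton, swap_apply_left,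
      swap_apply_right, swap_apply_of_ne_of_ne hac.symm hbc.symm,
      swap_apply_of_ne_of_ne had.symm hbd.symm, hσ a hac had, hσ b hbc hbd, hc, hd,
      swap_apply_left, swap_apply_right]
    ring
  · intro x _ hx
    simp only [Finset.mem_insert, Finset.mem_singleton, not_or] at hx
    rw [swap_apply_of_ne_of_ne hx.1 hx.2.1, swap_apply_of_ne_of_ne
      (fun h => hx.2.2.1 (σ.injective (h.trans hc.symm)))
      (fun h => hx.2.2.2 (σ.injective (h.trans hd.symm))), sub_self]

namespace HookCycle

/-- At an ascent `a, a + 1` of small elements such that `a + 1` and its mirror image form a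
subinterval of the cycle, this pair is the innermost one and there is no middle element. -/
theorem core_of_ascent (h : HookCycle p σ) {a b : Fin n} (hab : (b : ℕ) = a + 1)
    (hb : (b : ℕ) < p) (hlt : σ a < σ b) (ha : depth (σ a) = b) (hbr : σ b.rev = b) :
    (b : ℕ) + 1 = p ∧ ∀ x : Fin n, p ≤ (x : ℕ) → (x : ℕ) + p < n → σ x = x := by
  obtain ⟨h1, h2, -, -⟩ := h.ascent_lo hab hb hlt
  have hle := h.le
  have hma := h.moved_of_lt (x := a) (by omega)
  have hda : depth a = a := by simp only [depth]; omega
  have hvb := Fin.val_rev b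
  -- A moved element deeper than `b` would require an entry `z` of level `b + 1`. As `a` is the only
  -- entry of level `b`, `z` has depth exactly `b`; but neither `b` nor its mirror image goes
  -- deeper.
  have key : ∀ x, (b : ℕ) + 1 ≤ depth x → σ x = x := by
    intro x hx
    by_contra hxm
    obtain ⟨z, hz, hz'⟩ := h.exists_entry hxm hma hx (by omega)
    have hza : z ≠ a := by
      rintro rfl
      omega
    have hz2 : depth z = b := by
      by_contra hne
      exact hza (h.entry_unique b z a (by omega) (by omega) (by omega) h1)
    have hzb : z ≠ b := by
      rintro rfl
      omega
    have hzb' : z = b.rev := by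
      rw [Ne, Fin.ext_iff] at hzb
      rw [Fin.ext_iff]
      simp only [depth] at hz2
      omega
    rw [hzb', hbr] at hz'
    simp only [depth] at hz'
    omega
  refine ⟨?_, fun x hx hx' => key x (by simp only [depth]; omega)⟩
  by_contra hne
  refine h.moved_of_lt (x := ⟨b + 1, by omega⟩) (by simp only; omega) (key _ ?_)
  simp only [depth]
  omega

/-- The mirror image of `b` cannot leave level `b`, since `b` does. If both alternatives failed, it
would enter level `b + 1` together with `a`. -/
theorem depth_eq_or_of_ascent (h : HookCycle p σ) {a b : Fin n} (hab : (b : ℕ) = a + 1)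
    (hb : (b : ℕ) < p) (hlt : σ a < σ b) : depth (σ a) = b ∨ depth (σ⁻¹ b) = b := by
  obtain ⟨h1, h2, h3, -⟩ := h.ascent_lo hab hb hlt
  have hle := h.le
  by_contra! hne
  have hda : depth a = a := by simp only [depth]; omega
  have hdb : depth b = b := by simp only [depth]; omega
  have hdb' := depth_rev b
  have hvb := Fin.val_rev b
  have hmbr : σ b.rev ≠ b.rev := h.moved_of_ge (by omega)
  have h5 : (b : ℕ) ≤ depth (σ b.rev) := by
    by_contra hlt2
    have := h.exit_unique b b.rev b (by omega) (by omega) (by omega) h2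
    rw [Fin.ext_iff] at this
    omega
  have h6 : σ b.rev ≠ b := by
    intro h6
    have h7 := Perm.inv_eq_iff_eq.2 h6.symm
    rw [h7] at hne
    omega
  rw [Ne, Fin.ext_iff] at h6 hmbr
  have := h.entry_unique (b + 1) a b.rev (by omega) (by omega) (by omega)
    (by simp only [depth] at h5 ⊢; omega)
  rw [Fin.ext_iff] at this
  omega

/-- If both alternatives failed, `b` would leave level `a`, so the mirror image of `a` could not; it
would then enter level `b` together with `a`. -/
theorem depth_eq_or_of_ascent' (h : HookCycle p σ) {a b : Fin n} (hab : (b : ℕ) = a + 1)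
    (hb : (b : ℕ) < p) (hlt : σ a < σ b) : depth (σ b) = a ∨ depth (σ⁻¹ a) = a := by
  obtain ⟨h1, h2, -, h4⟩ := h.ascent_lo hab hb hlt
  have hle := h.le
  by_contra! hne
  have hda : depth a = a := by simp only [depth]; omega
  have hdb : depth b = b := by simp only [depth]; omega
  have hda' := depth_rev a
  have hva := Fin.val_rev a
  have hmar : σ a.rev ≠ a.rev := h.moved_of_ge (by omega)
  have h5 : (a : ℕ) ≤ depth (σ a.rev) := by
    by_contra hlt2
    have := h.exit_unique a a.rev b (by omega) (by omega) (by omega) (by omega)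
    rw [Fin.ext_iff] at this
    omega
  have h6 : σ a.rev ≠ a := by
    intro h6
    have h7 := Perm.inv_eq_iff_eq.2 h6.symm
    rw [h7] at hne
    omega
  rw [Ne, Fin.ext_iff] at h6 hmar
  have := h.entry_unique b a a.rev (by omega) (by omega) (by omega)
    (by simp only [depth] at h5 ⊢; omega)
  rw [Fin.ext_iff] at this
  omega

/-- Here `α, β, γ, δ` are the depths of `σ a`, `σ b`, `σ⁻¹ a`, `σ⁻¹ b`. The four differences are
respectively `a` or `-1`, `-a` or `0`, `-a` or `0`, `a` or `-1`, the first value occurring when `α =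
b`, `β = a`, `γ = a`, `δ = b`. Since `α = δ = b` is excluded, there is a `-1` and at most one `a`,
which is offset by a `-a`. -/
theorem crossing_add_lt {a b : ℕ} {α β γ δ : ℕ} (hab : b = a + 1) (hα : b ≤ α) (hβ : β < b)
    (hγ : γ < b) (hδ : b ≤ δ) (h1 : ¬(α = b ∧ δ = b)) (h2 : α = b ∨ δ = b)
    (h3 : β = a ∨ γ = a) :
    crossing b α - crossing a α + (crossing a β - crossing b β) +
      (crossing γ b - crossing γ a) + (crossing δ a - crossing δ b) < 0 := by
  rw [crossing_of_lt (u := a) (v := α) (by omega), crossing_of_gt hβ, crossing_of_lt hγ,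
    crossing_of_gt (u := δ) (v := a) (by omega)]
  have c1 : crossing b α = if α = b then 0 else -(b : ℤ) := by
    split_ifs with h5
    · rw [h5, crossing_self]
    · exact crossing_of_lt (by omega)
  have c2 : crossing a β = if β = a then 0 else (β : ℤ) := by
    split_ifs with h5
    · rw [h5, crossing_self]
    · exact crossing_of_gt (by omega)
  have c3 : crossing γ a = if γ = a then 0 else -(γ : ℤ) := by
    split_ifs with h5
    · rw [h5, crossing_self]
    · exact crossing_of_lt (by omega)
  have c4 : crossing δ b = if δ = b then 0 else (b : ℤ) := by
    split_ifs with h5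
    · rw [h5, crossing_self]
    · exact crossing_of_gt (by omega)
  rw [c1, c2, c3, c4]
  split_ifs <;> omega

theorem potential_lt_lo (h : HookCycle p σ) {a b : Fin n} (hab : (b : ℕ) = a + 1)
    (hb : (b : ℕ) < p) (hlt : σ a < σ b) :
    potential (swap a b * σ * swap a b) < potential σ ∨
      (b : ℕ) + 1 = p ∧ σ b.rev = b ∧ ∀ x : Fin n, p ≤ (x : ℕ) → (x : ℕ) + p < n → σ x = x := by
  obtain ⟨h1, h2, h3, h4⟩ := h.ascent_lo hab hb hlt
  have hle := h.le
  have hib := h.lo_inv b hb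
  have hia := h.lo_inv a (by omega)
  have hvb := Fin.val_rev b
  -- In this case the cycle runs through `a`, the mirror image of `b`, and then `b`, and the
  -- potential need not drop.
  by_cases hcore : depth (σ a) = b ∧ depth (σ⁻¹ b) = b
  · right
    have hbv : σ⁻¹ b = b.rev := by
      have := hcore.2
      simp only [depth] at this
      exact Fin.ext (by omega)
    have hbr : σ b.rev = b := by rw [← hbv, perm_apply_inv]
    have := h.core_of_ascent hab hb hlt hcore.1 hbr
    exact ⟨this.1, hbr, this.2⟩
  · left
    have hD := potential_conj_swap σ (perm_apply_inv σ a) (perm_apply_inv σ b)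
      (by rw [Ne, Fin.ext_iff]; omega) (by rw [Ne, Fin.ext_iff]; omega)
      (by rw [Ne, Fin.ext_iff]; omega) (by rw [Ne, Fin.ext_iff]; omega)
      (by rw [Ne, Fin.ext_iff]; omega)
    have hC := crossing_add_lt hab h1 h2 h4 h3 hcore (h.depth_eq_or_of_ascent hab hb hlt)
      (h.depth_eq_or_of_ascent' hab hb hlt)
    have hda : depth a = a := by simp only [depth]; omega
    have hdb : depth b = b := by simp only [depth]; omega
    rw [hda, hdb] at hD
    omega

/-- Neither preimage is small, and `σ⁻¹ a` has the smaller depth, hence is large and exceeds `σ⁻¹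
b`. So every ascent of small elements is an exchange. -/
theorem inv_gt_of_lt_lo (h : HookCycle p σ) {a b : Fin n} (hab : (b : ℕ) = a + 1)
    (hb : (b : ℕ) < p) (hlt : σ a < σ b) : σ⁻¹ b < σ⁻¹ a := by
  obtain ⟨-, -, h3, h4⟩ := h.ascent_lo hab hb hlt
  have hle := h.le
  have hia := h.lo_inv a (by omega)
  have hib := h.lo_inv b hb
  have := (σ⁻¹ a).isLt
  rw [Fin.lt_def]
  simp only [depth] at *
  omega

theorem exchange_lo (h : HookCycle p σ) {a b : Fin n} (hab : (b : ℕ) = a + 1)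
    (hb : (b : ℕ) < p) (hlt : σ a < σ b) : Exchange σ (swap a b * σ * swap a b) :=
  ⟨a, b, hab, rfl, Or.inl ⟨hlt, h.inv_gt_of_lt_lo hab hb hlt⟩⟩

theorem rev_conj_inv (σ : Perm (Fin n)) :
    (Fin.revPerm * σ * Fin.revPerm)⁻¹ = Fin.revPerm * σ⁻¹ * Fin.revPerm :=
  swap_conj_inv _ _ Fin.revPerm_symm

theorem exchange_hi (h : HookCycle p σ) {a b : Fin n} (hab : (b : ℕ) = a + 1)
    (ha : n < (a : ℕ) + 1 + p) (hlt : σ a < σ b) : Exchange σ (swap a b * σ * swap a b) := by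
  have hb := b.isLt
  have h1 := h.rev.inv_gt_of_lt_lo (a := b.rev) (b := a.rev) (by simp only [Fin.val_rev]; omega)
    (by simp only [Fin.val_rev]; omega) (by simpa using hlt)
  rw [rev_conj_inv] at h1
  simp only [Perm.mul_apply, Fin.revPerm_apply, Fin.rev_rev, Fin.rev_lt_rev] at h1
  exact ⟨a, b, hab, rfl, Or.inl ⟨hlt, h1⟩⟩

theorem potential_lt_hi (h : HookCycle p σ) {a b : Fin n} (hab : (b : ℕ) = a + 1)
    (ha : n < (a : ℕ) + 1 + p) (hlt : σ a < σ b) :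
    potential (swap a b * σ * swap a b) < potential σ ∨
      (a : ℕ) + p = n ∧ ∀ x : Fin n, p ≤ (x : ℕ) → (x : ℕ) + p < n → σ x = x := by
  have hb := b.isLt
  rcases h.rev.potential_lt_lo (a := b.rev) (b := a.rev) (by simp only [Fin.val_rev]; omega)
    (by simp only [Fin.val_rev]; omega) (by simpa using hlt) with h1 | ⟨h1, -, h2⟩
  · left
    rwa [← potential_rev, rev_conj_swap, potential_rev] at h1
  · right
    rw [Fin.val_rev] at h1
    refine ⟨by omega, fun x hx hx' => ?_⟩
    have := h2 x.rev (by rw [Fin.val_rev]; omega) (by rw [Fin.val_rev]; omega)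
    simpa using this

theorem exchange_boundary (h : HookCycle p σ) {a b : Fin n} (hab : (b : ℕ) = a + 1)
    (hb : (b : ℕ) = p) (hlt : σ a < σ b) : Exchange σ (swap a b * σ * swap a b) := by
  obtain ⟨-, h1, -⟩ := h.ascent_boundary hab hb hlt
  refine ⟨a, b, hab, rfl, Or.inl ⟨hlt, ?_⟩⟩
  have h2 := h.lo_inv a (by omega)
  rw [Perm.inv_eq_iff_eq.2 h1.symm, Fin.lt_def]
  omega

end HookCycle

end Potential

/-! ### Connectedness -/

section Connected

variable {n k p : ℕ} {σ τ : Perm (Fin n)}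

/-- The values of the element in stair form of the hook `(k, 1^{n-k})`, for `2 ≤ k`. -/
structure IsStair (k : ℕ) (σ : Perm (Fin n)) : Prop where
  lo : ∀ x : Fin n, (x : ℕ) < k / 2 → (σ x : ℕ) = n - 1 - x
  hi : ∀ x : Fin n, n ≤ (x : ℕ) + (k - 1) / 2 → (σ x : ℕ) = n - x
  last : ∀ x : Fin n, (k % 2 = 0 → (x : ℕ) + k / 2 = n) → (k % 2 = 1 → (x : ℕ) = k / 2) →
    (σ x : ℕ) = 0
  fixed : ∀ x : Fin n, k / 2 ≤ (x : ℕ) → (x : ℕ) + k / 2 < n → ¬(k % 2 = 1 ∧ (x : ℕ) = k / 2) →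
    σ x = x

theorem IsStair.unique (hk : 2 ≤ k) (hkn : k ≤ n) (hσ : IsStair k σ) (hτ : IsStair k τ) :
    σ = τ := by
  ext x
  have h1 := hσ.lo x
  have h2 := hτ.lo x
  have h3 := hσ.hi x
  have h4 := hτ.hi x
  have h5 := hσ.last x
  have h6 := hτ.last x
  by_cases h9 : k / 2 ≤ (x : ℕ) ∧ (x : ℕ) + k / 2 < n ∧ ¬(k % 2 = 1 ∧ (x : ℕ) = k / 2)
  · rw [hσ.fixed x h9.1 h9.2.1 h9.2.2, hτ.fixed x h9.1 h9.2.1 h9.2.2]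
  · omega

/-- The potential is bounded below, but some exchanges may not lower it. Those switch `bad` off and
no other exchange switches it on, so at most one occurs. Induction on the potential settles first
the permutations that are not bad, then all of them. -/
theorem reflTransGen_of_progress {G bad : Perm (Fin n) → Prop} {c : Perm (Fin n)}
    (hG : ∀ σ, G σ → σ = c ∨ ∃ τ, Exchange σ τ ∧ G τ ∧
      (potential τ < potential σ ∧ (bad τ → bad σ) ∨ bad σ ∧ ¬bad τ))
    (σ : Perm (Fin n)) (hσ : G σ) : Relation.ReflTransGen Exchange σ c := by
  have h1 : ∀ N : ℕ, ∀ σ, G σ → ¬bad σ → potential σ + (n : ℤ) * n ≤ N →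
      Relation.ReflTransGen Exchange σ c := by
    intro N
    induction N with
    | zero =>
      intro σ hσ hb hN
      rcases hG σ hσ with rfl | ⟨τ, _, _, h3 | h3⟩
      · exact Relation.ReflTransGen.refl
      · have := neg_le_potential τ
        omega
      · exact absurd h3.1 hb
    | succ N ih =>
      intro σ hσ hb hN
      rcases hG σ hσ with rfl | ⟨τ, h1, h2, h3 | h3⟩
      · exact Relation.ReflTransGen.refl
      · exact (ih τ h2 (fun h => hb (h3.2 h)) (by omega)).head h1
      · exact absurd h3.1 hb
  have h1' : ∀ σ, G σ → ¬bad σ → Relation.ReflTransGen Exchange σ c := fun σ hσ hb =>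
    h1 (potential σ + (n : ℤ) * n).toNat σ hσ hb (Int.self_le_toNat _)
  have h2 : ∀ N : ℕ, ∀ σ, G σ → potential σ + (n : ℤ) * n ≤ N →
      Relation.ReflTransGen Exchange σ c := by
    intro N
    induction N with
    | zero =>
      intro σ hσ hN
      rcases hG σ hσ with rfl | ⟨τ, h1, h2, h3 | h3⟩
      · exact Relation.ReflTransGen.refl
      · have := neg_le_potential τ
        omega
      · exact (h1' τ h2 h3.2).head h1
    | succ N ih =>
      intro σ hσ hN
      rcases hG σ hσ with rfl | ⟨τ, h1, h2, h3 | h3⟩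
      · exact Relation.ReflTransGen.refl
      · exact (ih τ h2 (by omega)).head h1
      · exact (h1' τ h2 h3.2).head h1
  exact h2 (potential σ + (n : ℤ) * n).toNat σ hσ (Int.self_le_toNat _)

/-- A decreasing map from `p` consecutive places into the `p` largest numbers is squeezed from both
ends. -/
theorem val_eq_of_descents_lo (hn : p ≤ n)
    (hanti : ∀ a b : Fin n, (b : ℕ) = a + 1 → (b : ℕ) < p → σ b < σ a)
    (hlarge : ∀ x : Fin n, (x : ℕ) < p → n ≤ (σ x : ℕ) + p) (x : Fin n) (hx : (x : ℕ) < p) :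
    (σ x : ℕ) = n - 1 - x := by
  have up : ∀ t : ℕ, ∀ x : Fin n, (x : ℕ) = t → (x : ℕ) < p → (σ x : ℕ) + t + 1 ≤ n := by
    intro t
    induction t with
    | zero => intro x _ _; have := (σ x).isLt; omega
    | succ t ih =>
      intro x hx hxp
      have h1 := hanti ⟨t, by omega⟩ x hx hxp
      have h2 := ih ⟨t, by omega⟩ rfl (by simp only; omega)
      rw [Fin.lt_def] at h1
      omega
  have down : ∀ t : ℕ, ∀ x : Fin n, (x : ℕ) + t + 1 = p → n + t ≤ (σ x : ℕ) + p := by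
    intro t
    induction t with
    | zero => intro x hx; exact hlarge x (by omega)
    | succ t ih =>
      intro x hx
      have h1 := hanti x ⟨x + 1, by omega⟩ rfl (by simp only; omega)
      have h2 := ih ⟨x + 1, by omega⟩ (by simp only; omega)
      rw [Fin.lt_def] at h1
      omega
  have h1 := up x x rfl hx
  have h2 := down (p - 1 - x) x (by omega)
  omega

theorem val_eq_of_descents_hi {m : ℕ} (hm : m ≤ n)
    (hanti : ∀ a b : Fin n, (b : ℕ) = a + 1 → n ≤ (a : ℕ) + m → σ b < σ a)
    (hle : ∀ x : Fin n, n ≤ (x : ℕ) + m → (σ x : ℕ) ≤ m)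
    (h0 : ∀ x : Fin n, (x : ℕ) + 1 = n → 1 ≤ m → 1 ≤ (σ x : ℕ)) (x : Fin n)
    (hx : n ≤ (x : ℕ) + m) : (σ x : ℕ) = n - x := by
  have down : ∀ t : ℕ, ∀ x : Fin n, (x : ℕ) + t + 1 = n → t < m → t + 1 ≤ (σ x : ℕ) := by
    intro t
    induction t with
    | zero => intro x hx ht; exact h0 x hx ht
    | succ t ih =>
      intro x hx ht
      have h1 := hanti x ⟨x + 1, by omega⟩ rfl (by omega)
      have h2 := ih ⟨x + 1, by omega⟩ (by simp only; omega) (by omega)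
      rw [Fin.lt_def] at h1
      omega
  have up : ∀ t : ℕ, ∀ x : Fin n, (x : ℕ) + m = n + t → (σ x : ℕ) + t ≤ m := by
    intro t
    induction t with
    | zero => intro x hx; exact hle x (by omega)
    | succ t ih =>
      intro x hx
      have hxl := x.isLt
      have h1 := hanti ⟨x - 1, by omega⟩ x (by simp only; omega) (by simp only; omega)
      have h2 := ih ⟨x - 1, by omega⟩ (by simp only; omega)
      rw [Fin.lt_def] at h1
      omega
  have hxl := x.isLt
  have h1 := up (x + m - n) x (by omega)
  have h2 := down (n - 1 - x) x (by omega) (by omega)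
  omega

namespace HookCycle

/-- The stair element sends `n - p` to `0`, so for `p > 1` it ascends at `n - p, n - p + 1`. Hence
descents among large elements are demanded only strictly above `n - p`. -/
theorem isStair_of_descents_even (h : HookCycle p σ)
    (hmid : ∀ x : Fin n, p ≤ (x : ℕ) → (x : ℕ) + p < n → σ x = x)
    (hlo : ∀ a b : Fin n, (b : ℕ) = a + 1 → (b : ℕ) < p → σ b < σ a)
    (hhi : ∀ a b : Fin n, (b : ℕ) = a + 1 → n < (a : ℕ) + p → σ b < σ a) :
    IsStair (2 * p) σ := by
  have hle := h.le
  have hpos := h.pos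
  have h1 := val_eq_of_descents_lo (by omega) hlo fun x hx => by
    by_contra hlt
    have h2 := h.lo x hx
    have h3 := hmid _ h2 (by omega)
    rw [σ.injective h3] at h2
    omega
  have h2 := val_eq_of_descents_hi (σ := σ) (m := p - 1) (by omega)
    (fun a b hab ha => hhi a b hab (by omega))
    (fun x hx => by
      have h2 := h.hi x (by omega)
      by_contra hlt
      rw [σ.injective (hmid (σ x) (by omega) h2)] at h2
      omega) fun x hx hm => by
    by_contra hlt
    have h3 : σ x = ⟨0, by omega⟩ := Fin.ext (by simp only; omega)
    have h4 : σ ⟨0, by omega⟩ = x := Fin.ext (by rw [h1 _ (by simp only; omega)]; simp only; omega)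
    -- A 2-cycle of `0` and `n - 1` leaves no room for `1`, which is moved because `2 ≤ p` here.
    rcases eq_or_eq_of_isCycle h.isCycle h4 h3 (by rw [Ne, Fin.ext_iff]; simp only; omega)
      (h.moved_of_lt (x := ⟨1, by omega⟩) (by simp only; omega)) with h5 | h5
    · simp [Fin.ext_iff] at h5
    · rw [Fin.ext_iff] at h5
      simp only at h5
      omega
  refine ⟨fun x hx => h1 x (by omega), fun x hx => h2 x (by omega), fun x hx _ => ?_,
    fun x hx hx' _ => hmid x (by omega) (by omega)⟩
  have h3 := hx (by omega)
  have h4 := h.hi x (by omega)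
  -- The values `1, …, p - 1` are already taken at the positions above `n - p`.
  by_contra hne
  have h5 : (σ x : ℕ) < p := by
    by_contra hlt
    have h6 := σ.injective (hmid (σ x) (by omega) h4)
    rw [h6] at h4
    omega
  have h6 := h2 ⟨n - σ x, by omega⟩ (by simp only; omega)
  have h7 : (⟨n - σ x, by omega⟩ : Fin n) = x :=
    σ.injective (Fin.ext (by rw [h6]; simp only; omega))
  rw [Fin.ext_iff] at h7
  simp only at h7
  omega

theorem isStair_of_descents_odd (h : HookCycle p σ) {m : Fin n} (hm : (m : ℕ) = p)
    (hmn : (m : ℕ) + p < n) (hmm : σ m ≠ m)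
    (hlo : ∀ a b : Fin n, (b : ℕ) = a + 1 → (b : ℕ) ≤ p → σ b < σ a)
    (hhi : ∀ a b : Fin n, (b : ℕ) = a + 1 → n ≤ (a : ℕ) + p → σ b < σ a) :
    IsStair (2 * p + 1) σ := by
  have hle := h.le
  have hpos := h.pos
  have hmid : ∀ x : Fin n, p ≤ (x : ℕ) → (x : ℕ) + p < n → x ≠ m → σ x = x := by
    intro x hx hx' hne
    by_contra hxm
    exact hne (h.mid_unique x m hx hx' (by omega) hmn hxm hmm)
  have houter : ∀ x : Fin n, σ x ≠ x → σ x ≠ m → (σ x : ℕ) < p ∨ n ≤ (σ x : ℕ) + p := by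
    intro x hx hx'
    by_contra! hcon
    exact hx (σ.injective (hmid _ hcon.1 hcon.2 hx'))
  have hmm' := hmm
  rw [Ne, Fin.ext_iff] at hmm'
  -- If `m` went to a large element, the descents up to `p` would produce `p + 1` distinct values
  -- among the `p` largest numbers.
  have hσm : (σ m : ℕ) < p := by
    by_contra hge
    have hl : n ≤ (σ m : ℕ) + p := (houter m hmm hmm).resolve_left hge
    have down : ∀ t : ℕ, ∀ x : Fin n, (x : ℕ) + t = p → n + t ≤ (σ x : ℕ) + p := by
      intro t
      induction t with
      | zero =>
        intro x hx
        rwa [show x = m from Fin.ext (by omega)]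
      | succ t ih =>
        intro x hx
        have h1 := hlo x ⟨x + 1, by omega⟩ rfl (by simp only; omega)
        have h2 := ih ⟨x + 1, by omega⟩ (by simp only; omega)
        rw [Fin.lt_def] at h1
        omega
    have := down p ⟨0, by omega⟩ (by simp)
    have := (σ ⟨0, by omega⟩).isLt
    omega
  have hpre : (m : ℕ) < (σ⁻¹ m : ℕ) := by
    have h1 := h.mid m (by omega) hmn
    rw [Fin.lt_def, Fin.lt_def] at h1
    have h2 : σ⁻¹ m ≠ m := fun he => hmm (Perm.inv_eq_iff_eq.1 he).symm
    rw [Ne, Fin.ext_iff] at h2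
    omega
  have h1 := val_eq_of_descents_lo (by omega) (fun a b hab hb => hlo a b hab hb.le) fun x hx => by
    have h2 := h.lo x hx
    have h3 : σ x ≠ m := by
      intro he
      rw [← he, perm_inv_apply, he] at hpre
      omega
    have := houter x (h.moved_of_lt hx) h3
    omega
  have hhile : ∀ x : Fin n, n ≤ (x : ℕ) + p → (σ x : ℕ) ≤ p := fun x hx => by
    have h2 := h.hi x hx
    by_contra hlt
    have := houter x (h.moved_of_ge hx) (by rw [Ne, Fin.ext_iff]; omega)
    omega
  have h2 := val_eq_of_descents_hi (σ := σ) (m := p) (by omega) hhi hhile fun x hx hm => by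
    by_contra hlt
    have h3 : σ x = ⟨0, by omega⟩ := Fin.ext (by simp only; omega)
    have h4 : σ ⟨0, by omega⟩ = x := Fin.ext (by rw [h1 _ (by simp only; omega)]; simp only; omega)
    rcases eq_or_eq_of_isCycle h.isCycle h4 h3 (by rw [Ne, Fin.ext_iff]; simp only; omega)
      hmm with h5 | h5
    · rw [Fin.ext_iff] at h5
      simp only at h5
      omega
    · rw [Fin.ext_iff] at h5
      omega
  refine ⟨fun x hx => h1 x (by omega), fun x hx => h2 x (by omega), fun x _ hx => ?_,
    fun x hx hx' hne => hmid x (by omega) (by omega) fun he => hne ⟨by omega, by omega⟩⟩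
  have h3 : x = m := Fin.ext (by have := hx (by omega); omega)
  subst h3
  by_contra hne
  have h6 := h2 ⟨n - σ x, by omega⟩ (by simp only; omega)
  have h7 : (⟨n - σ x, by omega⟩ : Fin n) = x :=
    σ.injective (Fin.ext (by rw [h6]; simp only; omega))
  rw [Fin.ext_iff] at h7
  simp only at h7
  omega

theorem reflTransGen_even (h : HookCycle p σ)
    (hmid : ∀ x : Fin n, p ≤ (x : ℕ) → (x : ℕ) + p < n → σ x = x) {c : Perm (Fin n)}
    (hc : IsStair (2 * p) c) : Relation.ReflTransGen Exchange σ c := by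
  have hle := h.le
  have hpos := h.pos
  -- `bad` says that the innermost pair is run through from its large element to its small one. The
  -- core case of `potential_lt_lo` ends this; that of `potential_lt_hi` sits at the position `n -
  -- p`, where no descent is demanded.
  refine reflTransGen_of_progress
    (G := fun σ => HookCycle p σ ∧ ∀ x : Fin n, p ≤ (x : ℕ) → (x : ℕ) + p < n → σ x = x)
    (bad := fun σ => ∀ x : Fin n, (x : ℕ) + p = n → (σ x : ℕ) + 1 = p) ?_ σ ⟨h, hmid⟩
  clear h hmid
  rintro σ ⟨h, hmid⟩
  have hmid' : ∀ a b : Fin n, (a : ℕ) < p ∧ (b : ℕ) < p ∨ n ≤ (a : ℕ) + p ∧ n ≤ (b : ℕ) + p →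
      ∀ x : Fin n, p ≤ (x : ℕ) → (x : ℕ) + p < n → (swap a b * σ * swap a b) x = x := by
    intro a b hab x hx hx'
    have h1 : swap a b x = x := swap_of_val_ne (by omega) (by omega)
    rw [Perm.mul_apply, Perm.mul_apply, h1, hmid x hx hx', h1]
  by_cases hlo : ∀ a b : Fin n, (b : ℕ) = a + 1 → (b : ℕ) < p → σ b < σ a
  · by_cases hhi : ∀ a b : Fin n, (b : ℕ) = a + 1 → n < (a : ℕ) + p → σ b < σ a
    · exact Or.inl ((h.isStair_of_descents_even hmid hlo hhi).unique (by omega) hle hc)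
    · right
      push Not at hhi
      obtain ⟨a, b, hab, ha, hlt⟩ := hhi
      have hlt : σ a < σ b := lt_of_le_of_ne hlt fun he => by
        have := congrArg Fin.val (σ.injective he)
        omega
      refine ⟨_, h.exchange_hi hab (by omega) hlt,
        ⟨h.conj_ascent hab hlt, hmid' a b (Or.inr ⟨by omega, by omega⟩)⟩, Or.inl ⟨?_, ?_⟩⟩
      · rcases h.potential_lt_hi hab (by omega) hlt with h1 | h1
        · exact h1
        · omega
      · intro hbad x hx
        have h1 := hbad x hx
        rw [Perm.mul_apply, Perm.mul_apply, swap_of_val_ne (x := x) (by omega) (by omega)] at h1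
        rwa [swap_of_val_ne (x := σ x)] at h1
        · intro he
          rw [show σ x = a from Fin.ext he, swap_apply_left] at h1
          omega
        · intro he
          rw [show σ x = b from Fin.ext he, swap_apply_right] at h1
          omega
  · right
    push Not at hlo
    obtain ⟨a, b, hab, hb, hlt⟩ := hlo
    have hlt : σ a < σ b := lt_of_le_of_ne hlt fun he => by
      have := congrArg Fin.val (σ.injective he)
      omega
    refine ⟨_, h.exchange_lo hab hb hlt,
      ⟨h.conj_ascent hab hlt, hmid' a b (Or.inl ⟨by omega, by omega⟩)⟩, ?_⟩
    rcases h.potential_lt_lo hab hb hlt with h1 | ⟨h1, h2, -⟩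
    · refine Or.inl ⟨h1, fun hbad x hx => ?_⟩
      have h2 := hbad x hx
      rw [Perm.mul_apply, Perm.mul_apply, swap_of_val_ne (x := x) (by omega) (by omega)] at h2
      by_cases hsa : σ x = a
      · rw [hsa, swap_apply_left] at h2
        obtain ⟨-, -, -, h3⟩ := h.ascent_lo hab hb hlt
        rw [← hsa, perm_inv_apply] at h3
        simp only [depth] at h3
        omega
      · by_cases hsb : σ x = b
        · rw [hsb, swap_apply_right] at h2
          omega
        · rwa [swap_apply_of_ne_of_ne hsa hsb] at h2
    · have hvb := Fin.val_rev b
      refine Or.inr ⟨fun x hx => ?_, fun hbad => ?_⟩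
      · rw [show x = b.rev from Fin.ext (by omega), h2, h1]
      · have h3 := hbad b.rev (by omega)
        rw [Perm.mul_apply, Perm.mul_apply, swap_of_val_ne (x := b.rev) (by omega) (by omega),
          h2, swap_apply_right] at h3
        omega

theorem reflTransGen_odd_of_eq (h : HookCycle p σ) {m : Fin n} (hm : (m : ℕ) = p)
    (hmn : (m : ℕ) + p < n) (hmm : σ m ≠ m) {c : Perm (Fin n)}
    (hc : IsStair (2 * p + 1) c) : Relation.ReflTransGen Exchange σ c := by
  have hle := h.le
  have hpos := h.pos
  -- `bad` says that the middle element is left upwards, which a boundary exchange reverses. The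
  -- core cases of the potential lemmas cannot occur, since they would fix `m`.
  refine reflTransGen_of_progress (G := fun σ => HookCycle p σ ∧ σ m ≠ m)
    (bad := fun σ => m < σ m) ?_ σ ⟨h, hmm⟩
  clear h hmm
  rintro σ ⟨h, hmm⟩
  have key : ∀ a b : Fin n, (a : ℕ) < p ∧ (b : ℕ) < p ∨ n ≤ (a : ℕ) + p ∧ n ≤ (b : ℕ) + p →
      (swap a b * σ * swap a b) m ≠ m ∧ (m < (swap a b * σ * swap a b) m → m < σ m) := by
    intro a b hab
    have h1 : swap a b m = m := swap_of_val_ne (by omega) (by omega)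
    rw [Perm.mul_apply, Perm.mul_apply, h1, Ne, swap_apply_eq_iff, h1]
    refine ⟨hmm, ?_⟩
    rw [swap_apply_def, Fin.lt_def, Fin.lt_def]
    split_ifs with h2 h3
    · rw [h2]; omega
    · rw [h3]; omega
    · exact id
  by_cases hlo : ∀ a b : Fin n, (b : ℕ) = a + 1 → (b : ℕ) ≤ p → σ b < σ a
  · by_cases hhi : ∀ a b : Fin n, (b : ℕ) = a + 1 → n ≤ (a : ℕ) + p → σ b < σ a
    · exact Or.inl ((h.isStair_of_descents_odd hm hmn hmm hlo hhi).unique (by omega) (by omega) hc)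
    · right
      push Not at hhi
      obtain ⟨a, b, hab, ha, hlt⟩ := hhi
      have hlt : σ a < σ b := lt_of_le_of_ne hlt fun he => by
        have := congrArg Fin.val (σ.injective he)
        omega
      obtain ⟨k1, k2⟩ := key a b (Or.inr ⟨by omega, by omega⟩)
      refine ⟨_, h.exchange_hi hab (by omega) hlt, ⟨h.conj_ascent hab hlt, k1⟩, Or.inl ⟨?_, k2⟩⟩
      rcases h.potential_lt_hi hab (by omega) hlt with h1 | h1
      · exact h1
      · exact absurd (h1.2 m (by omega) hmn) hmm
  · right
    push Not at hlo
    obtain ⟨a, b, hab, hb, hlt⟩ := hlo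
    have hlt : σ a < σ b := lt_of_le_of_ne hlt fun he => by
      have := congrArg Fin.val (σ.injective he)
      omega
    rcases hb.lt_or_eq with hb | hb
    · obtain ⟨k1, k2⟩ := key a b (Or.inl ⟨by omega, by omega⟩)
      refine ⟨_, h.exchange_lo hab hb hlt, ⟨h.conj_ascent hab hlt, k1⟩, Or.inl ⟨?_, k2⟩⟩
      rcases h.potential_lt_lo hab hb hlt with h1 | h1
      · exact h1
      · exact absurd (h1.2.2 m (by omega) hmn) hmm
    · obtain ⟨-, h1, h2⟩ := h.ascent_boundary hab hb hlt
      have hbm : b = m := Fin.ext (by omega)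
      subst hbm
      have h3 : (swap a b * σ * swap a b) b = a := by simp [h1]
      have h4 : a < b := by rw [Fin.lt_def]; omega
      refine ⟨_, h.exchange_boundary hab hb hlt, ⟨h.conj_ascent hab hlt, ?_⟩, Or.inr ⟨?_, ?_⟩⟩
      · rw [h3]
        exact h4.ne
      · rw [Fin.lt_def]
        omega
      · rw [h3]
        exact not_lt_of_gt h4

/-- The moved middle element slides down to `p` past fixed neighbours. Each slide is an exchange
because `mid` puts `σ m` and `σ⁻¹ m` on opposite sides of `m`. -/
theorem reflTransGen_odd (h : HookCycle p σ) {m : Fin n} (hm : p ≤ (m : ℕ))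
    (hmn : (m : ℕ) + p < n) (hmm : σ m ≠ m) {c : Perm (Fin n)}
    (hc : IsStair (2 * p + 1) c) : Relation.ReflTransGen Exchange σ c := by
  obtain ⟨d, hd⟩ := Nat.exists_eq_add_of_le hm
  induction d generalizing σ m with
  | zero => exact h.reflTransGen_odd_of_eq (by omega) hmn hmm hc
  | succ d ih =>
    obtain ⟨f, hf⟩ : ∃ f : Fin n, (m : ℕ) = f + 1 := ⟨⟨p + d, by omega⟩, by simp only; omega⟩
    have hfm : f ≠ m := by rw [Ne, Fin.ext_iff]; omega
    have hfix : ∀ x : Fin n, p ≤ (x : ℕ) → (x : ℕ) + p < n → x ≠ m → σ x = x := by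
      intro x hx hx' hne
      by_contra hxm
      exact hne (h.mid_unique x m hx hx' hm hmn hxm hmm)
    have hσf : σ f = f := hfix f (by omega) (by omega) hfm
    have hσf' : σ⁻¹ f = f := Perm.inv_eq_iff_eq.2 hσf.symm
    have h1 : σ m ≠ f := fun he => hfm (σ.injective (hσf.trans he.symm))
    have h2 : σ⁻¹ m ≠ f := fun he => hfm (σ⁻¹.injective (hσf'.trans he.symm))
    have h3 : σ⁻¹ m ≠ m := fun he => hmm (Perm.inv_eq_iff_eq.1 he).symm
    have h4 := h.mid m hm hmn
    have hex : Exchange σ (swap f m * σ * swap f m) := by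
      refine ⟨f, m, hf, rfl, ?_⟩
      rw [hσf, hσf']
      simp only [Ne, Fin.ext_iff, Fin.lt_def] at *
      omega
    refine (ih (h.exchange hex) (m := f) (by omega) (by omega) ?_ (by omega)).head hex
    rw [Perm.mul_apply, Perm.mul_apply, swap_apply_left, swap_apply_of_ne_of_ne h1 hmm]
    exact h1

end HookCycle

end Connected

/-! ### The element in stair form of a hook -/

section Stair

variable {n k : ℕ}

theorem val_stairEntry (i : Fin n) :
    (stairEntry i : ℕ) = if (i : ℕ) % 2 = 0 then (i : ℕ) / 2 else n - ((i : ℕ) + 1) / 2 := by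
  simp only [stairEntry]
  split_ifs <;> rfl

theorem stairEntry_injective : Function.Injective (stairEntry (n := n)) := by
  intro i j hij
  have h := congrArg Fin.val hij
  rw [val_stairEntry, val_stairEntry] at h
  apply Fin.ext
  split_ifs at h <;> omega

theorem formPerm_of_length_le_one {α : Type*} [DecidableEq α] {l : List α} (h : l.length ≤ 1) :
    l.formPerm = 1 := by
  match l, h with
  | [], _ => rfl
  | [_], _ => rfl
  | _ :: _ :: _, h => simp at h

theorem prod_formPerm_splitWrtCompositionAux_replicate {α : Type*} [DecidableEq α] (m : ℕ)
    (l : List α) :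
    ((l.splitWrtCompositionAux (List.replicate m 1)).map List.formPerm).prod = 1 := by
  induction m generalizing l with
  | zero => simp [List.splitWrtCompositionAux]
  | succ m ih =>
    rw [List.replicate_succ, List.splitWrtCompositionAux_cons, List.map_cons, List.prod_cons, ih,
      formPerm_of_length_le_one (by simp), one_mul]

theorem stairElement_hook (hk : 1 ≤ k) (hkn : k ≤ n) :
    stairElement (hook n k hk hkn) = ((List.ofFn (stairEntry (n := n))).take k).formPerm := by
  rw [stairElement, List.splitWrtComposition]
  simp only [hook]
  rw [List.splitWrtCompositionAux_cons, List.map_cons, List.prod_cons,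
    prod_formPerm_splitWrtCompositionAux_replicate, mul_one]

theorem nodup_take_stairEntry : ((List.ofFn (stairEntry (n := n))).take k).Nodup :=
  (List.nodup_ofFn.2 stairEntry_injective).sublist (List.take_sublist _ _)

theorem length_take_stairEntry (hkn : k ≤ n) :
    ((List.ofFn (stairEntry (n := n))).take k).length = k := by
  simpa using hkn

theorem stairElement_hook_apply (hk : 1 ≤ k) (hkn : k ≤ n) {i : ℕ} (hi : i < k) :
    stairElement (hook n k hk hkn) (stairEntry ⟨i, by omega⟩) =
      stairEntry ⟨(i + 1) % k, (Nat.mod_lt _ hk).trans_le hkn⟩ := by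
  have hlen := length_take_stairEntry hkn
  have h := List.formPerm_apply_getElem _ (nodup_take_stairEntry (n := n) (k := k)) i (by omega)
  rw [stairElement_hook]
  simpa [hkn] using h

theorem stairElement_hook_one (hn : 1 ≤ n) : stairElement (hook n 1 le_rfl hn) = 1 := by
  rw [stairElement_hook]
  exact formPerm_of_length_le_one (by simp)

theorem isCycle_stairElement_hook (hk : 2 ≤ k) (hkn : k ≤ n) :
    (stairElement (hook n k (by omega) hkn)).IsCycle := by
  rw [stairElement_hook]
  exact List.isCycle_formPerm nodup_take_stairEntry (by rw [length_take_stairEntry hkn]; exact hk)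

theorem isStair_stairElement_hook (hk : 2 ≤ k) (hkn : k ≤ n) :
    IsStair k (stairElement (hook n k (by omega) hkn)) where
  lo x hx := by
    have h := stairElement_hook_apply (by omega) hkn (i := 2 * x) (by omega)
    rw [show stairEntry ⟨2 * (x : ℕ), _⟩ = x from
      Fin.ext (by rw [val_stairEntry, if_pos (by simp only; omega)]; simp only; omega)] at h
    rw [h, val_stairEntry]
    simp only
    rw [Nat.mod_eq_of_lt (a := 2 * (x : ℕ) + 1) (by omega), if_neg (by omega)]
    omega
  hi x hx := by
    have hxl := x.isLt
    have h := stairElement_hook_apply (by omega) hkn (i := 2 * (n - 1 - x) + 1) (by omega)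
    rw [show stairEntry ⟨2 * (n - 1 - (x : ℕ)) + 1, _⟩ = x from
      Fin.ext (by rw [val_stairEntry, if_neg (by simp only; omega)]; simp only; omega)] at h
    rw [h, val_stairEntry]
    simp only
    rw [Nat.mod_eq_of_lt (a := 2 * (n - 1 - (x : ℕ)) + 1 + 1) (by omega), if_pos (by omega)]
    omega
  last x hx hx' := by
    have h := stairElement_hook_apply (by omega) hkn (i := k - 1) (by omega)
    rw [show stairEntry ⟨k - 1, _⟩ = x from
      Fin.ext (by rw [val_stairEntry]; simp only; split_ifs <;> omega)] at h
    rw [h, val_stairEntry]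
    simp [Nat.sub_add_cancel (show 1 ≤ k by omega)]
  fixed x hx hx' hne := by
    rw [stairElement_hook]
    refine List.formPerm_apply_of_notMem fun hmem => ?_
    obtain ⟨i, hi, hix⟩ := List.getElem_of_mem hmem
    rw [length_take_stairEntry hkn] at hi
    rw [List.getElem_take, List.getElem_ofFn] at hix
    have h := congrArg Fin.val hix
    rw [val_stairEntry] at h
    simp only at h
    split_ifs at h <;> omega

/-- Depth never decreases along the list `1, n, 2, n - 1, …`, so only the edge closing the cycle can
leave a level. -/
theorem IsStair.hookCycle (hk : 2 ≤ k) (hkn : k ≤ n) {σ : Perm (Fin n)} (h : IsStair k σ)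
    (hσ : σ.IsCycle) : HookCycle (k / 2) σ where
  isCycle := hσ
  pos := by omega
  le := by omega
  mid_unique x y hx hx' hy hy' hxm hym := by
    have h1 : k % 2 = 1 ∧ (x : ℕ) = k / 2 := by
      by_contra hne
      exact hxm (h.fixed x hx hx' hne)
    have h2 : k % 2 = 1 ∧ (y : ℕ) = k / 2 := by
      by_contra hne
      exact hym (h.fixed y hy hy' hne)
    exact Fin.ext (by omega)
  lo x hx := by
    rw [h.lo x hx]
    omega
  hi x hx := by
    have h1 := h.hi x
    have h2 := h.last x
    have hxl := x.isLt
    omega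
  mid x hx hx' := by
    by_cases h1 : k % 2 = 1 ∧ (x : ℕ) = k / 2
    · have h2 := h.last x (fun h2 => by omega) fun _ => h1.2
      have h3 : σ ⟨n - k / 2, by omega⟩ = x :=
        Fin.ext (by rw [h.hi _ (by simp only; omega)]; simp only; omega)
      rw [Perm.inv_eq_iff_eq.2 h3.symm, Fin.lt_def, Fin.lt_def]
      simp only
      omega
    · have h2 := h.fixed x hx hx' h1
      rw [Perm.inv_eq_iff_eq.2 h2.symm, h2]
  exit_unique j x y hx hxj hy hyj := by
    have key : ∀ x : Fin n, j ≤ depth x → depth (σ x) < j →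
        (k % 2 = 0 → (x : ℕ) + k / 2 = n) ∧ (k % 2 = 1 → (x : ℕ) = k / 2) := by
      intro x hx hxj
      have hxl := x.isLt
      by_contra hlast
      by_cases h1 : k / 2 ≤ (x : ℕ) ∧ (x : ℕ) + k / 2 < n
      · rw [h.fixed x h1.1 h1.2 (fun h2 => hlast ⟨fun h3 => by omega, fun _ => h2.2⟩)] at hxj
        omega
      · have h2 := h.lo x
        have h3 := h.hi x
        simp only [depth] at *
        omega
    obtain ⟨h1, h2⟩ := key x hx hxj
    obtain ⟨h3, h4⟩ := key y hy hyj
    exact Fin.ext (by omega)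

/-! ### Supports of hook cycles and the class of the stair element -/

theorem card_outer {p : ℕ} (h : 2 * p ≤ n) :
    (Finset.univ.filter fun x : Fin n => (x : ℕ) < p ∨ n ≤ (x : ℕ) + p).card = 2 * p := by
  have h1 : (Finset.univ.filter fun x : Fin n => n ≤ (x : ℕ) + p).card =
      (Finset.univ.filter fun x : Fin n => (x : ℕ) < p).card := by
    refine Finset.card_equiv Fin.revPerm fun x => ?_
    have := x.isLt
    simp only [Finset.mem_filter, Finset.mem_univ, true_and, Fin.revPerm_apply, Fin.val_rev]
    omega
  rw [Finset.filter_or, Finset.card_union_of_disjoint, h1, Fin.card_filter_val_lt]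
  · omega
  · refine Finset.disjoint_filter.2 fun x _ => ?_
    omega

theorem HookCycle.support_subset {p : ℕ} {σ : Perm (Fin n)} (h : HookCycle p σ) :
    (Finset.univ.filter fun x : Fin n => (x : ℕ) < p ∨ n ≤ (x : ℕ) + p) ⊆ σ.support := by
  intro x hx
  rw [Finset.mem_filter] at hx
  rw [Perm.mem_support]
  exact hx.2.elim h.moved_of_lt h.moved_of_ge

theorem HookCycle.card_support_of_fixed {p : ℕ} {σ : Perm (Fin n)} (h : HookCycle p σ)
    (hmid : ∀ x : Fin n, p ≤ (x : ℕ) → (x : ℕ) + p < n → σ x = x) : σ.support.card = 2 * p := by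
  rw [← card_outer h.le]
  congr 1
  refine Finset.Subset.antisymm (fun x hx => ?_) h.support_subset
  rw [Perm.mem_support] at hx
  rw [Finset.mem_filter]
  refine ⟨Finset.mem_univ _, ?_⟩
  by_contra! hcon
  exact hx (hmid x hcon.1 hcon.2)

theorem HookCycle.card_support_of_moved {p : ℕ} {σ : Perm (Fin n)} (h : HookCycle p σ) {m : Fin n}
    (hm : p ≤ (m : ℕ)) (hmn : (m : ℕ) + p < n) (hmm : σ m ≠ m) :
    σ.support.card = 2 * p + 1 := by
  have h1 : m ∉ Finset.univ.filter fun x : Fin n => (x : ℕ) < p ∨ n ≤ (x : ℕ) + p := by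
    rw [Finset.mem_filter]
    omega
  rw [← card_outer h.le, ← Finset.card_insert_of_notMem h1]
  congr 1
  refine Finset.Subset.antisymm (fun x hx => ?_)
    (Finset.insert_subset (Perm.mem_support.2 hmm) h.support_subset)
  rw [Perm.mem_support] at hx
  rw [Finset.mem_insert, Finset.mem_filter]
  by_contra! hcon
  have := hcon.2 (Finset.mem_univ _)
  exact hcon.1 (h.mid_unique x m this.1 this.2 hm hmn hx hmm)

theorem HookCycle.reflTransGen_stair {σ c : Perm (Fin n)} (h : HookCycle (k / 2) σ)
    (hcard : σ.support.card = k) (hc : IsStair k c) : Relation.ReflTransGen Exchange σ c := by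
  by_cases hmid : ∀ x : Fin n, k / 2 ≤ (x : ℕ) → (x : ℕ) + k / 2 < n → σ x = x
  · have h1 := h.card_support_of_fixed hmid
    exact h.reflTransGen_even hmid (by rwa [show 2 * (k / 2) = k by omega])
  · push Not at hmid
    obtain ⟨m, hm, hmn, hmm⟩ := hmid
    have h1 := h.card_support_of_moved hm hmn hmm
    exact h.reflTransGen_odd hm hmn hmm (by rwa [show 2 * (k / 2) + 1 = k by omega])

theorem Exchange.card_support_eq {σ τ : Perm (Fin n)} (h : Exchange σ τ) :
    τ.support.card = σ.support.card := by
  obtain ⟨a, b, -, rfl, -⟩ := h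
  have := Perm.card_support_conj (σ := swap a b) (τ := σ)
  rwa [swap_inv] at this

theorem reflTransGen_exchange_symm {σ τ : Perm (Fin n)}
    (h : Relation.ReflTransGen Exchange σ τ) : Relation.ReflTransGen Exchange τ σ := by
  induction h with
  | refl => exact Relation.ReflTransGen.refl
  | tail _ h ih => exact ih.head h.symm

/-- The size of the support, invariant under conjugation, separates `2 * p` from `2 * p + 1`, which
share the same `k / 2`. -/
theorem mem_sigmaClass_hook_iff (hk : 2 ≤ k) (hkn : k ≤ n) (σ : Perm (Fin n)) :
    σ ∈ SigmaClass (hook n k (by omega) hkn) ↔ HookCycle (k / 2) σ ∧ σ.support.card = k := by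
  have hst := isStair_stairElement_hook hk hkn
  have hcyc := hst.hookCycle hk hkn (isCycle_stairElement_hook hk hkn)
  rw [SigmaClass, Set.mem_ofPred_eq, approx_iff_reflTransGen]
  constructor
  · intro h
    have hcard : (stairElement (hook n k (by omega) hkn)).support.card = k := by
      rw [stairElement_hook, List.support_formPerm_of_nodup _ nodup_take_stairEntry,
        List.toFinset_card_of_nodup nodup_take_stairEntry, length_take_stairEntry hkn]
      intro x hx
      have := congrArg List.length hx
      rw [length_take_stairEntry hkn, List.length_singleton] at this
      omega
    induction h with
    | refl => exact ⟨hcyc, hcard⟩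
    | tail _ h1 ih => exact ⟨ih.1.exchange h1, h1.card_support_eq.trans ih.2⟩
  · rintro ⟨h1, h2⟩
    exact reflTransGen_exchange_symm (h1.reflTransGen_stair h2 hst)

end Stair

/-! ### The hook properties of a cycle in terms of its entries -/

section Cycles

variable {n r p : ℕ}

theorem isConnectedIn_iff {τ : Perm (Fin r)} (ht : ∀ x y, ∃ i : ℕ, (τ ^ i) x = y)
    {M : Set (Fin r)} (hM : M.Nonempty) :
    IsConnectedIn τ M ↔ ∀ x ∈ M, ∀ y ∈ M, τ x ∉ M → τ y ∉ M → x = y := by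
  classical
  have closed : ∀ (P : Fin r → Prop) (x y : Fin r), (∀ z, P z → P (τ z)) → P x → P y := by
    intro P x y hP hx
    obtain ⟨i, rfl⟩ := ht x y
    induction i with
    | zero => exact hx
    | succ i ih =>
      rw [pow_succ', Perm.mul_apply]
      exact hP _ ih
  constructor
  · rintro ⟨x₀, -, hMeq⟩ x hx y hy hx' hy'
    have key : ∀ x ∈ M, τ x ∉ M → ∃ j : ℕ, j + 1 = M.ncard ∧ x = (τ ^ j) x₀ := by
      intro x hx hx'
      rw [hMeq] at hx
      obtain ⟨j, hj, rfl⟩ := hx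
      refine ⟨j, ?_, rfl⟩
      by_contra hne
      refine hx' ?_
      rw [hMeq]
      exact ⟨j + 1, by omega, by rw [pow_succ', Perm.mul_apply]⟩
    obtain ⟨i, hi, rfl⟩ := key x hx hx'
    obtain ⟨j, hj, rfl⟩ := key y hy hy'
    rw [show i = j by omega]
  · intro huniq
    -- The run through `M` starts at an element where `M` is entered; if there is none, `M` is
    -- everything.
    obtain ⟨x₀, hx₀, hx₀'⟩ : ∃ x₀ ∈ M, τ⁻¹ x₀ ∈ M → M = Set.univ := by
      by_cases hcl : ∀ x ∈ M, τ x ∈ M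
      · obtain ⟨x₀, hx₀⟩ := hM
        exact ⟨x₀, hx₀, fun _ => Set.eq_univ_of_forall fun y => closed (· ∈ M) x₀ y hcl hx₀⟩
      · push Not at hcl
        obtain ⟨z, hz, hz'⟩ := hcl
        by_contra! hcon
        refine closed (· ∉ M) (τ z) z (fun u hu hu' => hu ?_) hz' hz
        have := (hcon _ hu').1
        rwa [perm_inv_apply] at this
    -- If the run `A` from `x₀` left `M` too early, it would miss some `w ∈ M`. But `M` without `A`
    -- is closed under `τ`, the only exit of `M` being in `A`, so by transitivity it would contain
    -- `x₀`.
    have hmem : ∀ j < M.ncard, (τ ^ j) x₀ ∈ M := by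
      by_contra! hcon
      obtain ⟨hjN, hjM⟩ := Nat.find_spec hcon
      have hmin : ∀ i < Nat.find hcon, (τ ^ i) x₀ ∈ M := by
        intro i hi
        have := Nat.find_min hcon hi
        push Not at this
        exact this (hi.trans hjN)
      set j := Nat.find hcon
      have hj : j ≠ 0 := by
        intro hj
        rw [hj] at hjM
        exact hjM hx₀
      set A : Set (Fin r) := ↑((Finset.range j).image fun i => (τ ^ i) x₀) with hA
      have hAmem : ∀ u, u ∈ A ↔ ∃ i < j, (τ ^ i) x₀ = u := by
        intro u
        simp [hA]
      have hAcard : A.ncard < M.ncard := by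
        rw [hA, Set.ncard_coe_finset]
        exact (Finset.card_image_le.trans (Finset.card_range j).le).trans_lt hjN
      have hexit : τ ((τ ^ (j - 1)) x₀) ∉ M := by
        rwa [← Perm.mul_apply, ← pow_succ', Nat.sub_add_cancel (by omega)]
      obtain ⟨w, hw, hwA⟩ := Set.exists_mem_notMem_of_ncard_lt_ncard hAcard
      refine (closed (fun u => u ∈ M ∧ u ∉ A) w x₀ ?_ ⟨hw, hwA⟩).2
        ((hAmem _).2 ⟨0, by omega, rfl⟩)
      rintro u ⟨hu, huA⟩
      refine ⟨?_, fun h => ?_⟩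
      · by_contra huM
        exact huA ((hAmem _).2 ⟨j - 1, by omega, huniq _ (hmin _ (by omega)) _ hu hexit huM⟩)
      · obtain ⟨i, hi, hiu⟩ := (hAmem _).1 h
        cases i with
        | zero =>
          rw [pow_zero, Perm.one_apply] at hiu
          have h1 := hx₀' (by rw [hiu, perm_inv_apply]; exact hu)
          rw [h1] at hjM
          exact hjM (Set.mem_univ _)
        | succ i =>
          rw [pow_succ', Perm.mul_apply] at hiu
          exact huA ((hAmem _).2 ⟨i, by omega, τ.injective hiu⟩)
    have hinj : ∀ i j, i < j → j < M.ncard → (τ ^ i) x₀ ≠ (τ ^ j) x₀ := by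
      intro i j hij hj heq
      have hd : (τ ^ (j - i)) x₀ = x₀ := by
        apply (τ ^ i).injective
        rw [← Perm.mul_apply, ← pow_add, Nat.add_sub_cancel' hij.le, heq]
      have hall : ∀ y, y ∈ (Finset.range (j - i)).image fun t => (τ ^ t) x₀ := by
        intro y
        refine closed (· ∈ (Finset.range (j - i)).image fun t => (τ ^ t) x₀) x₀ y ?_ ?_
        · intro u hu
          rw [Finset.mem_image] at hu ⊢
          obtain ⟨t, ht, rfl⟩ := hu
          rw [Finset.mem_range] at ht
          by_cases h1 : t + 1 = j - i
          · refine ⟨0, Finset.mem_range.2 (by omega), ?_⟩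
            rw [← Perm.mul_apply, ← pow_succ', h1, hd, pow_zero, Perm.one_apply]
          · exact ⟨t + 1, Finset.mem_range.2 (by omega), by rw [pow_succ', Perm.mul_apply]⟩
        · exact Finset.mem_image.2 ⟨0, Finset.mem_range.2 (by omega), rfl⟩
      have h1 : r ≤ j - i := by
        have h2 := Finset.card_le_card (fun y _ => hall y : Finset.univ ⊆ _)
        rw [Finset.card_univ, Fintype.card_fin] at h2
        exact h2.trans (Finset.card_image_le.trans (Finset.card_range _).le)
      have h2 : M.ncard ≤ r := by
        have := Set.ncard_le_card M
        rwa [Nat.card_eq_fintype_card, Fintype.card_fin] at this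
      omega
    refine ⟨x₀, hx₀, ?_⟩
    set A : Finset (Fin r) := (Finset.range M.ncard).image fun i => (τ ^ i) x₀ with hA
    have hAM : (A : Set (Fin r)) = M := by
      refine Set.eq_of_subset_of_ncard_le ?_ ?_ (Set.toFinite M)
      · intro u hu
        rw [Finset.mem_coe, hA, Finset.mem_image] at hu
        obtain ⟨i, hi, rfl⟩ := hu
        exact hmem i (Finset.mem_range.1 hi)
      · rw [Set.ncard_coe_finset, hA, Finset.card_image_of_injOn, Finset.card_range]
        intro i hi j hj heq
        rw [Finset.mem_coe, Finset.mem_range] at hi hj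
        rcases lt_trichotomy i j with h | h | h
        · exact absurd heq (hinj i j h hj)
        · exact h
        · exact absurd heq.symm (hinj j i h hi)
    ext y
    constructor
    · intro hy
      rw [← hAM, Finset.mem_coe, hA, Finset.mem_image] at hy
      obtain ⟨i, hi, rfl⟩ := hy
      exact ⟨i, Finset.mem_range.1 hi, rfl⟩
    · rintro ⟨i, hi, rfl⟩
      exact hmem i hi

/-- For odd `r` the witness is `m = p` or `m = p + 1` according to whether the middle element is
sent down or up; `mid` places its predecessor on the other side. -/
theorem cycleOscillating_iff (hp : 1 ≤ p) (hr : r = 2 * p ∨ r = 2 * p + 1) (τ : Perm (Fin r))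
    (hτ : ∀ i, τ i ≠ i) :
    CycleOscillating τ ↔ (∀ i : Fin r, (i : ℕ) < p → p ≤ (τ i : ℕ)) ∧
      (∀ i : Fin r, r ≤ (i : ℕ) + p → (τ i : ℕ) + p < r) ∧
      ∀ i : Fin r, p ≤ (i : ℕ) → (i : ℕ) + p < r → (i < τ i ↔ τ⁻¹ i < i) := by
  have himage : ∀ m : ℕ, m ≤ r → (τ '' interval r 1 m = interval r (r - m + 1) r ↔
      ∀ i : Fin r, (i : ℕ) < m ↔ r ≤ (τ i : ℕ) + m) := by
    intro m hm
    rw [Set.ext_iff, τ.surjective.forall]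
    refine forall_congr' fun i => ?_
    rw [τ.injective.mem_set_image]
    have := (τ i).isLt
    simp only [interval, Set.mem_ofPred_eq]
    omega
  constructor
  · rintro ⟨m, hm0, hm, himg⟩
    have h1 := (himage m (by omega)).1 himg
    refine ⟨fun i hi => ?_, fun i hi => ?_, fun i hi hi' => ?_⟩
    · have := h1 i
      omega
    · have := h1 i
      omega
    · have h2 := h1 i
      have h3 := h1 (τ⁻¹ i)
      have h4 := hτ i
      have h5 := hτ (τ⁻¹ i)
      rw [perm_apply_inv] at h3 h5
      rw [Ne, Fin.ext_iff] at h4 h5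
      rw [Fin.lt_def, Fin.lt_def]
      omega
  · rintro ⟨hlo, hhi, hmid⟩
    rcases hr with hr | hr
    · refine ⟨p, hp, by omega, (himage p (by omega)).2 fun i => ?_⟩
      have h1 := hlo i
      have h2 := hhi i
      omega
    · obtain ⟨c, hc⟩ : ∃ c : Fin r, (c : ℕ) = p := ⟨⟨p, by omega⟩, rfl⟩
      have h1 := hmid c (by omega) (by omega)
      have h2 := hτ c
      have h3 := hτ (τ⁻¹ c)
      rw [perm_apply_inv] at h3
      rw [Ne, Fin.ext_iff] at h2 h3
      rw [Fin.lt_def, Fin.lt_def] at h1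
      have hc1 : ∀ i : Fin r, (i : ℕ) = p → i = c := fun i hi => Fin.ext (by omega)
      have hc2 : ∀ i : Fin r, (τ i : ℕ) = p → i = τ⁻¹ c := fun i hi =>
        (Perm.inv_eq_iff_eq.2 (hc1 _ hi).symm).symm
      by_cases hlt : (τ c : ℕ) < p
      · refine ⟨p, hp, by omega, (himage p (by omega)).2 fun i => ?_⟩
        have h4 := hlo i
        have h5 := hhi i
        by_cases hi : (i : ℕ) = p
        · rw [hc1 i hi]
          omega
        · by_cases hi2 : (τ i : ℕ) = p
          · have h6 := hc2 i hi2
            rw [Fin.ext_iff] at h6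
            omega
          · omega
      · refine ⟨p + 1, by omega, by omega, (himage (p + 1) (by omega)).2 fun i => ?_⟩
        have h4 := hlo i
        have h5 := hhi i
        by_cases hi : (i : ℕ) = p
        · rw [hc1 i hi]
          omega
        · by_cases hi2 : (τ i : ℕ) = p
          · have h6 := hc2 i hi2
            rw [Fin.ext_iff] at h6
            omega
          · omega

/-- The interval with index `j` is level `j - 1`, and levels from `p` on contain at most one
element, so quantifying over all `j` adds nothing. -/
theorem cycleConnectedIntervals_iff (hr : r = 2 * p ∨ r = 2 * p + 1)
    {τ : Perm (Fin r)} (ht : ∀ x y, ∃ i : ℕ, (τ ^ i) x = y) :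
    CycleConnectedIntervals τ ↔ ∀ (j : ℕ) (x y : Fin r), j ≤ depth x → depth (τ x) < j →
      j ≤ depth y → depth (τ y) < j → x = y := by
  have hmem : ∀ j : ℕ, 1 ≤ j → 2 * j ≤ r → ∀ x : Fin r,
      x ∈ interval r j (r - j + 1) ↔ j - 1 ≤ depth x := by
    intro j hj hjr x
    have := x.isLt
    simp only [interval, Set.mem_ofPred_eq, depth]
    omega
  have hiff : ∀ j : ℕ, 1 ≤ j → 2 * j ≤ r → (IsConnectedIn τ (interval r j (r - j + 1)) ↔
      ∀ x y : Fin r, j - 1 ≤ depth x → depth (τ x) < j - 1 → j - 1 ≤ depth y →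
        depth (τ y) < j - 1 → x = y) := by
    intro j hj hjr
    rw [isConnectedIn_iff ht ⟨⟨j - 1, by omega⟩, (hmem j hj hjr _).2 (by
      simp only [depth]; omega)⟩]
    simp only [hmem j hj hjr, not_le]
    exact ⟨fun h x y hx hx' hy hy' => h x hx y hy hx' hy',
      fun h x hx y hy hx' hy' => h x y hx hx' hy hy'⟩
  constructor
  · intro h j x y hx hx' hy hy'
    by_cases hj : j < p
    · exact (hiff (j + 1) (by omega) (by omega)).1 (h (j + 1) (by omega) (by omega)) x y hx hx'
        hy hy'
    · have hxl := x.isLt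
      have hyl := y.isLt
      simp only [depth] at hx hy
      exact Fin.ext (by omega)
  · intro h j hj hjr
    exact (hiff j hj hjr).2 (h (j - 1))

theorem exists_pow_eq_of_isCycle {τ : Perm (Fin r)} (hτ : ∀ i, τ i ≠ i) (h : τ.IsCycle)
    (x y : Fin r) : ∃ i : ℕ, (τ ^ i) x = y :=
  (h.sameCycle (hτ x) (hτ y)).exists_nat_pow_eq

/-- For a cycle on all of `[r]`. -/
theorem hookCycle_iff (hp : 1 ≤ p) (hr : r = 2 * p ∨ r = 2 * p + 1) {τ : Perm (Fin r)}
    (hτ : ∀ i, τ i ≠ i) (hc : τ.IsCycle) :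
    HookCycle p τ ↔ CycleOscillating τ ∧ CycleConnectedIntervals τ := by
  rw [cycleOscillating_iff hp hr τ hτ,
    cycleConnectedIntervals_iff hr (exists_pow_eq_of_isCycle hτ hc)]
  refine ⟨fun h => ⟨⟨h.lo, h.hi, h.mid⟩, h.exit_unique⟩, fun ⟨⟨h1, h2, h3⟩, h4⟩ => ?_⟩
  exact ⟨hc, hp, by omega, fun x y hx hx' hy hy' _ _ => Fin.ext (by omega), h1, h2, h3, h4⟩

end Cycles

/-! ### Standardization -/

section Standardization

variable {n r k p : ℕ}

/-- The increasing embeddings of `[r]` into `[n]` whose images contain the `p` smallest and the `p`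
largest elements. -/
structure OuterEmb (p : ℕ) (e : Fin r → Fin n) : Prop where
  mono : StrictMono e
  pos : 1 ≤ p
  card : r = 2 * p ∨ r = 2 * p + 1
  le : 2 * p ≤ n
  outer : ∀ x : Fin n, (x : ℕ) < p ∨ n ≤ (x : ℕ) + p → ∃ i, e i = x

namespace OuterEmb

variable {e : Fin r → Fin n}

theorem le_val (h : OuterEmb p e) (i : Fin r) : (i : ℕ) ≤ e i := by
  obtain ⟨i, hi⟩ := i
  induction i with
  | zero => exact Nat.zero_le _
  | succ i ih =>
    have h1 := ih (by omega)
    have h2 : e ⟨i, by omega⟩ < e ⟨i + 1, hi⟩ := h.mono (by simp)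
    rw [Fin.lt_def] at h2
    simp only at h1 ⊢
    omega

theorem val_le (h : OuterEmb p e) (i : Fin r) : (e i : ℕ) + r ≤ i + n := by
  have key : ∀ t : ℕ, ∀ i : Fin r, (i : ℕ) + t + 1 = r → (e i : ℕ) + r ≤ i + n := by
    intro t
    induction t with
    | zero => intro i hi; have := (e i).isLt; omega
    | succ t ih =>
      intro i hi
      have h1 := ih ⟨i + 1, by omega⟩ (by simp only; omega)
      have h2 : e i < e ⟨i + 1, by omega⟩ := h.mono (by rw [Fin.lt_def]; simp)
      rw [Fin.lt_def] at h2
      simp only at h1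
      omega
  have := i.isLt
  exact key (r - 1 - i) i (by omega)

theorem val_of_lt (h : OuterEmb p e) (i : Fin r) (hi : (i : ℕ) < p) : (e i : ℕ) = i := by
  obtain ⟨i, hir⟩ := i
  have hle := h.le
  induction i using Nat.strong_induction_on with
  | _ i ih =>
    simp only at hi
    obtain ⟨⟨j, hj⟩, hji⟩ := h.outer ⟨i, by omega⟩ (Or.inl hi)
    have h1 := h.le_val ⟨j, hj⟩
    rw [hji] at h1
    simp only at h1
    rcases h1.lt_or_eq with h2 | h2
    · have h3 := ih j h2 hj (by simp only; omega)
      rw [hji] at h3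
      simp only at h3
      omega
    · subst h2
      rw [hji]

theorem val_of_ge (h : OuterEmb p e) (i : Fin r) (hi : r ≤ (i : ℕ) + p) :
    (e i : ℕ) + r = i + n := by
  have hle := h.le
  have key : ∀ t : ℕ, ∀ i : Fin r, (i : ℕ) + t + 1 = r → t < p → (e i : ℕ) + r = i + n := by
    intro t
    induction t using Nat.strong_induction_on with
    | _ t ih =>
      intro i hi ht
      obtain ⟨j, hji⟩ := h.outer ⟨i + n - r, by have := h.val_le i; omega⟩
        (Or.inr (by simp only; omega))
      have h1 := h.val_le j
      have h0 := h.val_le i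
      have hv := congrArg Fin.val hji
      simp only at hv
      have hjr := j.isLt
      by_cases h2 : (j : ℕ) = i
      · rw [Fin.ext h2] at hv
        omega
      · have h3 := ih (r - 1 - j) (by omega) j (by omega) (by omega)
        omega
  have := i.isLt
  exact key (r - 1 - i) i (by omega) (by omega)

theorem val_lt_iff (h : OuterEmb p e) (i : Fin r) : (e i : ℕ) < p ↔ (i : ℕ) < p := by
  have h1 := h.le_val i
  have h2 := h.val_of_lt i
  omega

theorem le_val_iff (h : OuterEmb p e) (i : Fin r) : n ≤ (e i : ℕ) + p ↔ r ≤ (i : ℕ) + p := by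
  have h1 := h.val_le i
  have h2 := h.val_of_ge i
  omega

/-- Outer elements keep their depth, and a middle one stays at depth at least `p`, whence the bound
on `j`. -/
theorem le_depth_iff (h : OuterEmb p e) {j : ℕ} (hj : j ≤ p) (i : Fin r) :
    j ≤ depth (e i) ↔ j ≤ depth i := by
  have h0 := h.le
  have h1 := h.le_val i
  have h2 := h.val_le i
  have h3 := h.val_of_lt i
  have h4 := h.val_of_ge i
  have h5 := h.card
  have h6 := (e i).isLt
  have h7 := i.isLt
  simp only [depth]
  omega

/-- The conditions of `HookCycle` do not notice fixed points inserted between the outer blocks: they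
use only the order of the moved elements and depths up to `p`, and deeper levels contain at most one
moved element. -/
theorem hookCycle_iff (h : OuterEmb p e) {σ : Perm (Fin n)} {τ : Perm (Fin r)}
    (hστ : ∀ i, σ (e i) = e (τ i)) (hfix : ∀ x, (∀ i, e i ≠ x) → σ x = x) :
    HookCycle p σ ↔ HookCycle p τ := by
  have hinj := h.mono.injective
  have hcard := h.card
  have hinv : ∀ i, σ⁻¹ (e i) = e (τ⁻¹ i) := fun i => by
    rw [Perm.inv_eq_iff_eq, hστ, perm_apply_inv]
  have hpow : ∀ (m : ℕ) i, (σ ^ m) (e i) = e ((τ ^ m) i) := by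
    intro m
    induction m with
    | zero => intro i; rfl
    | succ m ih => intro i; rw [pow_succ, Perm.mul_apply, hστ, ih, pow_succ, Perm.mul_apply]
  have hne : ∀ i, σ (e i) ≠ e i ↔ τ i ≠ i := fun i => by rw [hστ, hinj.ne_iff]
  have hmoved : ∀ x, σ x ≠ x → ∃ i, e i = x := by
    intro x hx
    by_contra! hcon
    exact hx (hfix x hcon)
  have hmidval : ∀ i : Fin r, p ≤ (e i : ℕ) → (e i : ℕ) + p < n →
      p ≤ (i : ℕ) ∧ (i : ℕ) + p < r := by
    intro i hi hi'
    have h1 := h.val_lt_iff i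
    have h2 := h.le_val_iff i
    omega
  constructor
  · intro hσ
    refine ⟨?_, h.pos, by omega, ?_, ?_, ?_, ?_, ?_⟩
    · obtain ⟨x, hx, hx'⟩ := hσ.isCycle
      obtain ⟨i, rfl⟩ := hmoved x hx
      refine ⟨i, (hne i).1 hx, fun j hj => ?_⟩
      obtain ⟨m, hm⟩ := (hx' ((hne j).2 hj)).exists_nat_pow_eq
      rw [hpow] at hm
      exact ⟨m, by rw [zpow_natCast]; exact hinj hm⟩
    · intro x y hx hx' hy hy' _ _
      exact Fin.ext (by omega)
    · intro i hi
      have h1 := hσ.lo _ ((h.val_lt_iff i).2 hi)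
      rw [hστ] at h1
      have h2 := h.val_lt_iff (τ i)
      omega
    · intro i hi
      have h1 := hσ.hi _ ((h.le_val_iff i).2 hi)
      rw [hστ] at h1
      have h2 := h.le_val_iff (τ i)
      omega
    · intro i hi hi'
      have h1 := h.val_lt_iff i
      have h2 := h.le_val_iff i
      have h3 := hσ.mid (e i) (by omega) (by omega)
      rwa [hστ, hinv, h.mono.lt_iff_lt, h.mono.lt_iff_lt] at h3
    · intro j x y hx hx' hy hy'
      by_cases hj : j ≤ p
      · rw [← not_le, ← h.le_depth_iff hj, ← hστ, not_le] at hx' hy'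
        rw [← h.le_depth_iff hj] at hx hy
        exact hinj (hσ.exit_unique j _ _ hx hx' hy hy')
      · have := x.isLt
        have := y.isLt
        simp only [depth] at hx hy
        exact Fin.ext (by omega)
  · intro hτ
    refine ⟨?_, h.pos, h.le, ?_, ?_, ?_, ?_, ?_⟩
    · obtain ⟨i, hi, hi'⟩ := hτ.isCycle
      refine ⟨e i, (hne i).2 hi, fun y hy => ?_⟩
      obtain ⟨j, rfl⟩ := hmoved y hy
      obtain ⟨m, hm⟩ := (hi' ((hne j).1 hy)).exists_nat_pow_eq
      exact ⟨m, by rw [zpow_natCast, hpow, hm]⟩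
    · intro x y hx hx' hy hy' hxm hym
      obtain ⟨i, rfl⟩ := hmoved x hxm
      obtain ⟨j, rfl⟩ := hmoved y hym
      have h1 := hmidval i hx hx'
      have h2 := hmidval j hy hy'
      rw [show i = j from Fin.ext (by omega)]
    · intro x hx
      obtain ⟨i, rfl⟩ := h.outer x (Or.inl hx)
      have h1 := hτ.lo _ ((h.val_lt_iff i).1 hx)
      have h2 := h.val_lt_iff (τ i)
      rw [hστ]
      omega
    · intro x hx
      obtain ⟨i, rfl⟩ := h.outer x (Or.inr hx)
      have h1 := hτ.hi _ ((h.le_val_iff i).1 hx)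
      have h2 := h.le_val_iff (τ i)
      rw [hστ]
      omega
    · intro x hx hx'
      by_cases hxm : σ x = x
      · rw [Perm.inv_eq_iff_eq.2 hxm.symm, hxm]
      · obtain ⟨i, rfl⟩ := hmoved x hxm
        have h1 := hmidval i hx hx'
        rw [hστ, hinv, h.mono.lt_iff_lt, h.mono.lt_iff_lt]
        exact hτ.mid i h1.1 h1.2
    · intro j x y hx hxj hy hyj
      obtain ⟨i, rfl⟩ := hmoved x fun he => by rw [he] at hxj; omega
      obtain ⟨i', rfl⟩ := hmoved y fun he => by rw [he] at hyj; omega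
      by_cases hj : j ≤ p
      · rw [hστ, ← not_le, h.le_depth_iff hj, not_le] at hxj hyj
        rw [h.le_depth_iff hj] at hx hy
        rw [hτ.exit_unique j i i' hx hxj hy hyj]
      · have h1 := (e i).isLt
        have h2 := (e i').isLt
        simp only [depth] at hx hy
        have h3 := hmidval i (by omega) (by omega)
        have h4 := hmidval i' (by omega) (by omega)
        rw [show i = i' from Fin.ext (by omega)]

end OuterEmb

theorem mem_orbit {σ : Perm (Fin n)} {x y : Fin n} : y ∈ orbit σ x ↔ σ.SameCycle x y := by
  simp [orbit]

theorem coe_orderIsoOfFin_cst (σ : Perm (Fin n)) (x : Fin n) (i : Fin (orbit σ x).card) :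
    (((orbit σ x).orderIsoOfFin rfl (cst σ x i) : orbit σ x) : Fin n) =
      σ ((orbit σ x).orderIsoOfFin rfl i : orbit σ x) := by
  simp [cst, permCongr_apply, Perm.subtypePerm_apply]

theorem orbit_of_fixed {σ : Perm (Fin n)} {x : Fin n} (hx : σ x = x) : orbit σ x = {x} := by
  ext y
  rw [mem_orbit, Finset.mem_singleton]
  constructor
  · intro h
    by_contra hne
    exact hne (h.eq_of_left hx).symm
  · rintro rfl
    exact Perm.SameCycle.refl _ _

theorem orbit_of_isCycle {σ : Perm (Fin n)} (hσ : σ.IsCycle) {x : Fin n} (hx : σ x ≠ x) :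
    orbit σ x = σ.support := by
  ext y
  rw [mem_orbit, Perm.mem_support]
  exact ⟨fun h hy => hx (h.apply_eq_self_iff.2 hy), fun hy => hσ.sameCycle hx hy⟩

theorem cycleOscillating_of_eq_one (hr : r = 1) (τ : Perm (Fin r)) : CycleOscillating τ := by
  subst hr
  refine ⟨1, by omega, by omega, ?_⟩
  ext i
  have h1 := i.isLt
  constructor
  · intro _
    exact ⟨by omega, by omega⟩
  · intro _
    exact ⟨i, ⟨by omega, by omega⟩, Subsingleton.elim _ _⟩

theorem cycleConnectedIntervals_of_eq_one (hr : r = 1) (τ : Perm (Fin r)) :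
    CycleConnectedIntervals τ := by
  intro j hj hjr
  omega

/-- The increasing enumeration of the long cycle is an `OuterEmb` once all outer elements are moved;
this is the role of the third hook property. -/
theorem hookCycle_iff_cst {σ : Perm (Fin n)} (hσ : σ.IsCycle) (hk : 2 ≤ k)
    (hcard : σ.support.card = k)
    (houter : ∀ x : Fin n, (x : ℕ) < k / 2 ∨ n ≤ (x : ℕ) + k / 2 → σ x ≠ x) {x : Fin n}
    (hx : σ x ≠ x) : HookCycle (k / 2) σ ↔
      CycleOscillating (cst σ x) ∧ CycleConnectedIntervals (cst σ x) := by
  have horb := orbit_of_isCycle hσ hx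
  have hr : (orbit σ x).card = k := by rw [horb, hcard]
  have hkn : k ≤ n := by
    rw [← hcard]
    simpa using Finset.card_le_univ σ.support
  set e : Fin (orbit σ x).card → Fin n := fun i => ((orbit σ x).orderIsoOfFin rfl i : orbit σ x)
  have hmem : ∀ y, σ y ≠ y → ∃ i, e i = y := by
    intro y hy
    have hy' : y ∈ orbit σ x := by rwa [horb, Perm.mem_support]
    exact ⟨((orbit σ x).orderIsoOfFin rfl).symm ⟨y, hy'⟩,
      congrArg Subtype.val (OrderIso.apply_symm_apply _ _)⟩
  have hmoved : ∀ i, σ (e i) ≠ e i := by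
    intro i
    have h1 : e i ∈ orbit σ x := ((orbit σ x).orderIsoOfFin rfl i).2
    exact Perm.mem_support.1 ((Finset.ext_iff.1 horb (e i)).1 h1)
  have hE : OuterEmb (k / 2) e := by
    refine ⟨fun i j hij => ?_, by omega, by omega, by omega, fun y hy => hmem y (houter y hy)⟩
    exact ((orbit σ x).orderIsoOfFin rfl).strictMono hij
  have hστ : ∀ i, σ (e i) = e (cst σ x i) := fun i => (coe_orderIsoOfFin_cst σ x i).symm
  have hfix : ∀ y, (∀ i, e i ≠ y) → σ y = y := by
    intro y hy
    by_contra hne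
    obtain ⟨i, hi⟩ := hmem y hne
    exact hy i hi
  have hτ : ∀ i, cst σ x i ≠ i := fun i hi => hmoved i (by rw [hστ, hi])
  have hpow : ∀ (m : ℕ) i, (σ ^ m) (e i) = e ((cst σ x ^ m) i) := by
    intro m
    induction m with
    | zero => intro i; rfl
    | succ m ih => intro i; rw [pow_succ, Perm.mul_apply, hστ, ih, pow_succ, Perm.mul_apply]
  have hcyc : (cst σ x).IsCycle := by
    obtain ⟨i, hi⟩ := hmem x hx
    refine ⟨i, hτ i, fun j _ => ?_⟩
    obtain ⟨m, hm⟩ := (hσ.sameCycle (hmoved i) (hmoved j)).exists_nat_pow_eq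
    rw [hpow] at hm
    exact ⟨m, by rw [zpow_natCast]; exact hE.mono.injective hm⟩
  rw [hE.hookCycle_iff hστ hfix, SymMax.hookCycle_iff hE.pos hE.card hτ hcyc]

theorem hookProperties_iff {σ : Perm (Fin n)} (hσ : σ.IsCycle) (hk : 2 ≤ k)
    (hcard : σ.support.card = k) : HookProperties k σ ↔ HookCycle (k / 2) σ := by
  have hkn : k ≤ n := by
    rw [← hcard]
    simpa using Finset.card_le_univ σ.support
  constructor
  · rintro ⟨h1, h2, h3⟩
    obtain ⟨c, hc, -, h4⟩ := h3 (by omega)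
    rw [Perm.cycleFactorsFinset_eq_singleton_iff.2 ⟨hσ, rfl⟩, Finset.mem_singleton] at hc
    subst hc
    obtain ⟨x, hx, -⟩ := id hσ
    refine (hookCycle_iff_cst hσ hk hcard (fun y hy => ?_) hx).2 ⟨h1 x, h2 x⟩
    have hyl := y.isLt
    have hyr := Fin.val_rev y
    rcases hy with hy | hy
    · exact Perm.mem_support.1 (h4 (y + 1) (by omega) (by omega) y y.rev rfl (by omega)).1
    · exact Perm.mem_support.1 (h4 (n - y) (by omega) (by omega) y.rev y (by omega) (by omega)).2
  · intro h
    have houter : ∀ x : Fin n, (x : ℕ) < k / 2 ∨ n ≤ (x : ℕ) + k / 2 → σ x ≠ x :=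
      fun x hx => hx.elim h.moved_of_lt h.moved_of_ge
    refine ⟨fun x => ?_, fun x => ?_, fun _ => ⟨σ, ?_, hcard, fun i hi hik a b ha hb => ?_⟩⟩
    · by_cases hx : σ x = x
      · exact cycleOscillating_of_eq_one (by rw [orbit_of_fixed hx, Finset.card_singleton]) _
      · exact ((hookCycle_iff_cst hσ hk hcard houter hx).1 h).1
    · by_cases hx : σ x = x
      · exact cycleConnectedIntervals_of_eq_one
          (by rw [orbit_of_fixed hx, Finset.card_singleton]) _
      · exact ((hookCycle_iff_cst hσ hk hcard houter hx).1 h).2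
    · rw [Perm.cycleFactorsFinset_eq_singleton_iff.2 ⟨hσ, rfl⟩, Finset.mem_singleton]
    · rw [Perm.mem_support, Perm.mem_support]
      exact ⟨houter a (Or.inl (by omega)), houter b (Or.inr (by omega))⟩

theorem hookProperties_one : HookProperties 1 (1 : Perm (Fin n)) where
  oscillating x := cycleOscillating_of_eq_one
    (by rw [orbit_of_fixed (Perm.one_apply x), Finset.card_singleton]) _
  connectedIntervals x := cycleConnectedIntervals_of_eq_one
    (by rw [orbit_of_fixed (Perm.one_apply x), Finset.card_singleton]) _
  mem_cycle h := absurd h (lt_irrefl 1)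

/-! ### Permutations of hook type and the inductive product -/

theorem cycleType_of_isOfType_hook (hk : 1 ≤ k) (hkn : k ≤ n) {σ : Perm (Fin n)}
    (h : IsOfType σ (hook n k hk hkn)) : σ.cycleType = if 2 ≤ k then {k} else 0 := by
  have h1 := Perm.filter_parts_partition_eq_cycleType (σ := σ)
  rw [IsOfType] at h
  rw [h] at h1
  rw [← h1]
  simp only [hook, ← Multiset.cons_coe, Multiset.filter_cons]
  rw [show ((List.replicate (n - k) 1 : List ℕ) : Multiset ℕ) = Multiset.replicate (n - k) 1
    from Multiset.coe_replicate _ _, Multiset.filter_eq_nil.2]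
  · split_ifs <;> rfl
  · intro a ha
    rw [Multiset.eq_of_mem_replicate ha]
    omega

theorem isCycle_of_isOfType_hook (hk : 2 ≤ k) (hkn : k ≤ n) {σ : Perm (Fin n)}
    (h : IsOfType σ (hook n k (by omega) hkn)) : σ.IsCycle ∧ σ.support.card = k := by
  have h1 := cycleType_of_isOfType_hook (by omega) hkn h
  rw [if_pos hk] at h1
  refine ⟨?_, ?_⟩
  · rw [← Perm.card_cycleType_eq_one, h1, Multiset.card_singleton]
  · rw [← Perm.sum_cycleType, h1, Multiset.sum_singleton]

theorem single_eq_hook (hk : 1 ≤ k) : Composition.single k hk = hook k k hk le_rfl := by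
  apply Composition.ext
  simp [hook, Composition.single]

theorem inductiveProduct_one_apply {n₁ n₂ : ℕ} (h : n₁ + n₂ = n) (σ : Perm (Fin n₁))
    (i : Fin n₁) : inductiveProduct h σ 1 (embLeft h i) = embLeft h (σ i) := by
  rw [inductiveProduct, show (1 : Perm (Fin n₂)).viaFintypeEmbedding (embRight h) = 1 from
    Perm.extendDomain_one _, mul_one]
  exact Perm.viaFintypeEmbedding_apply_image _ _ _

theorem inductiveProduct_one_apply_of_notMem {n₁ n₂ : ℕ} (h : n₁ + n₂ = n) (σ : Perm (Fin n₁))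
    {x : Fin n} (hx : ∀ i, embLeft h i ≠ x) : inductiveProduct h σ 1 x = x := by
  rw [inductiveProduct, show (1 : Perm (Fin n₂)).viaFintypeEmbedding (embRight h) = 1 from
    Perm.extendDomain_one _, mul_one]
  exact Perm.viaFintypeEmbedding_apply_notMem_range _ _ fun ⟨i, hi⟩ => hx i hi

theorem val_embLeft {n₁ n₂ : ℕ} (h : n₁ + n₂ = n) (i : Fin n₁) :
    (embLeft h i : ℕ) = if (i : ℕ) + 1 ≤ (n₁ + 1) / 2 then (i : ℕ) else i + n₂ := by
  change ((ite _ _ _ : Fin n) : ℕ) = _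
  split_ifs <;> rfl

theorem outerEmb_embLeft {n₂ : ℕ} (h : 2 * p + n₂ = n) (hp : 1 ≤ p) :
    OuterEmb p (embLeft h) := by
  refine ⟨fun i j hij => ?_, hp, Or.inl rfl, by omega, fun x hx => ?_⟩
  · rw [Fin.lt_def] at hij ⊢
    rw [val_embLeft, val_embLeft]
    split_ifs <;> omega
  · have hxl := x.isLt
    rcases hx with hx | hx
    · refine ⟨⟨x, by omega⟩, Fin.ext ?_⟩
      rw [val_embLeft, if_pos (by simp only; omega)]
    · refine ⟨⟨x - n₂, by omega⟩, Fin.ext ?_⟩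
      rw [val_embLeft, if_neg (by simp only; omega)]
      simp only
      omega

theorem bijOn_inductiveProduct (hp : 1 ≤ p) {n₂ : ℕ} (h : 2 * p + n₂ = n) :
    Set.BijOn (fun σ : Perm (Fin (2 * p)) => inductiveProduct h σ 1)
      {σ | HookCycle p σ ∧ σ.support.card = 2 * p}
      {σ | HookCycle p σ ∧ σ.support.card = 2 * p} := by
  have hE := outerEmb_embLeft h hp
  have hiff : ∀ σ : Perm (Fin (2 * p)), HookCycle p (inductiveProduct h σ 1) ↔ HookCycle p σ :=
    fun σ => hE.hookCycle_iff (fun i => inductiveProduct_one_apply h σ i)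
      fun x hx => inductiveProduct_one_apply_of_notMem h σ hx
  have hmid : ∀ (x : Fin n), p ≤ (x : ℕ) → (x : ℕ) + p < n → ∀ i, embLeft h i ≠ x := by
    rintro x hx hx' i rfl
    have h1 := hE.val_lt_iff i
    have h2 := hE.le_val_iff i
    have := i.isLt
    omega
  refine ⟨?_, ?_, ?_⟩
  · rintro σ ⟨h1, -⟩
    have h2 := (hiff σ).2 h1
    exact ⟨h2, h2.card_support_of_fixed fun x hx hx' =>
      inductiveProduct_one_apply_of_notMem h σ (hmid x hx hx')⟩
  · intro σ _ τ _ hστ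
    ext i
    have h1 := congrArg (fun f : Perm (Fin n) => f (embLeft h i)) hστ
    simp only [inductiveProduct_one_apply, EmbeddingLike.apply_eq_iff_eq] at h1
    rw [h1]
  · rintro σ ⟨h1, h2⟩
    -- A moved middle element would make the support odd. So `σ` lives on the outer elements, which
    -- form the range of `embLeft`, and it can be restricted to them.
    have hfix : ∀ x : Fin n, p ≤ (x : ℕ) → (x : ℕ) + p < n → σ x = x := by
      intro x hx hx'
      by_contra hxm
      have := h1.card_support_of_moved hx hx' hxm
      omega
    have hrange : ∀ x, σ x ≠ x → ∃ i, embLeft h i = x := by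
      intro x hx
      refine hE.outer x ?_
      by_contra! hcon
      exact hx (hfix x hcon.1 hcon.2)
    have hnfix : ∀ i, σ (embLeft h i) ≠ embLeft h i := by
      intro i he
      have h3 := h1.moved_of_lt (x := embLeft h i)
      have h4 := h1.moved_of_ge (x := embLeft h i)
      exact hmid (embLeft h i) (by by_contra hc; exact h3 (by omega) he)
        (by by_contra hc; exact h4 (by omega) he) i rfl
    have hex : ∀ i, ∃ j, embLeft h j = σ (embLeft h i) := fun i =>
      hrange _ fun he => hnfix i (σ.injective he)
    choose f hf using hex
    have hfinj : Function.Injective f := by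
      intro i j hij
      refine (embLeft h).injective (σ.injective ?_)
      rw [← hf, ← hf, hij]
    set τ : Perm (Fin (2 * p)) := Equiv.ofBijective f (Finite.injective_iff_bijective.1 hfinj)
    have hτ : inductiveProduct h τ 1 = σ := by
      ext x
      by_cases hx : ∃ i, embLeft h i = x
      · obtain ⟨i, rfl⟩ := hx
        rw [inductiveProduct_one_apply, ← hf]
        rfl
      · push Not at hx
        rw [inductiveProduct_one_apply_of_notMem h τ hx]
        by_contra hne
        obtain ⟨i, hi⟩ := hrange x fun he => hne (by rw [he])
        exact hx i hi
    have h3 : HookCycle p τ := (hiff τ).1 (by rwa [hτ])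
    exact ⟨τ, ⟨h3, h3.card_support_of_fixed fun x hx hx' => by omega⟩, hτ⟩

end Standardization

end SymMax

theorem mainTheorem9 (n k : ℕ) (hk : 1 ≤ k) (hkn : k ≤ n) :
    (∀ σ : Equiv.Perm (Fin n), SymMax.IsOfType σ (SymMax.hook n k hk hkn) →
      (σ ∈ SymMax.SigmaClass (SymMax.hook n k hk hkn) ↔ SymMax.HookProperties k σ)) ∧
    (Even k → Set.BijOn
      (fun σ : Equiv.Perm (Fin k) =>
        SymMax.inductiveProduct (Nat.add_sub_cancel' hkn) σ (1 : Equiv.Perm (Fin (n - k))))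
      (SymMax.SigmaClass (Composition.single k hk))
      (SymMax.SigmaClass (SymMax.hook n k hk hkn))) := by
  refine ⟨fun σ hσ => ?_, fun heven => ?_⟩
  -- For `k = 1` there is no long cycle, so `HookCycle` does not apply; the type forces the
  -- identity.
  · rcases hk.eq_or_lt with rfl | hk2
    · have h1 := SymMax.cycleType_of_isOfType_hook hk hkn hσ
      rw [if_neg (by omega), Equiv.Perm.cycleType_eq_zero] at h1
      subst h1
      refine iff_of_true ?_ SymMax.hookProperties_one
      rw [SymMax.SigmaClass, Set.mem_ofPred_eq, SymMax.stairElement_hook_one]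
      exact ⟨Relation.ReflTransGen.refl, Relation.ReflTransGen.refl⟩
    · obtain ⟨h1, h2⟩ := SymMax.isCycle_of_isOfType_hook hk2 hkn hσ
      rw [SymMax.mem_sigmaClass_hook_iff hk2 hkn, SymMax.hookProperties_iff h1 hk2 h2]
      exact and_iff_left h2
  · obtain ⟨p, hp⟩ := heven
    obtain rfl : k = 2 * p := by omega
    have hclass : ∀ (m : ℕ) (hm : 2 * p ≤ m), SymMax.SigmaClass (SymMax.hook m (2 * p) hk hm) =
        {σ | SymMax.HookCycle p σ ∧ σ.support.card = 2 * p} := by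
      intro m hm
      ext σ
      rw [SymMax.mem_sigmaClass_hook_iff (by omega) hm, show 2 * p / 2 = p by omega]
      rfl
    rw [SymMax.single_eq_hook, hclass, hclass]
    exact SymMax.bijOn_inductiveProduct (by omega) _
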